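/- **Conventions.** A word-length function on a countable group $G$ is a map $L:G\to\mathbb R$ with $L(1)=0$, $L(g^{-1})=L(g)$, $L(gh)\le L(g)+L(h)$. A homomorphism $f:(G,L)\to(G',L')$ of groups with word length is a homomorphism with $L'(f(g))=\min\{L(h): f(h)=f(g)\}$ for all $g$; a short exact sequence $(K,L_K)\to(G,L_G)\to(N,L_N)$ of groups with word length is a short exact sequence $K\overset{i}\rightarrowtail G\overset{p}\twoheadrightarrow N$ of such homomorphisms. A p-semi-normed (p.s.) $G$-module is a $\mathbb Q[G]$-module $M$ with a family of semi-norms $\{\eta_x\}_{x\in\Lambda}$ indexed by a countable set $\Lambda$ with a map $G\times\Lambda\to\Lambda$, $(g,x)\mapsto gx$, $1x=x$ (for instance a left or a right $G$-set), such that (i) for $x_1,\dots,x_r\in\Lambda$ ($r\ge 1$) and positive integers $\lambda_1,\dots,\lambda_r$ there are a constant $C$ and $y\in\Lambda$ with $\sum_j\lambda_j\eta_{x_j}\le C\eta_y$; (ii) there are $C,n$ such that for each $x'\in\Lambda$ there is $x\in\Lambda$ with $\eta_{gx'}(hm)\le C(1+L(h))^n\,\eta_{(gh)x}(m)$ for all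 $g,h\in G$, $m\in M$. If $P$ is the $\mathbb Q$-vector space on a weighted set $T$ (with weights $|t|\ge 0$) and $M$ is a p.s. $G$-module, $\mathrm{PHom}(P,M)$ is the space of linear maps $f:P\to M$ for which there is an $n$ such that for every $x\in\Lambda$ there is a $C$ with $\eta_{gx}(f(t))\le C(2+|t|)^n(1+L(g))^n$ for all $g\in G$, $t\in T$; $\mathrm{PHom}_G(P,M)$ is the subspace of $G$-equivariant maps. $EG_*$ is the bar resolution: $EG_n$ has basis $G^{n+1}$, weights $|(g_0,\dots,g_n)|=1+\sum_j L(g_j)$, left multiplication of $G$ on $g_0$, and $d(g_0,\dots,g_n)=\sum_{j<n}(-1)^j(\dots,g_jg_{j+1},\dots)+(-1)^n(g_0,\dots,g_{n-1})$. Put $PH^n(G;M)=H^n(\mathrm{PHom}_G(EG_*,M))$. **Theorem (5-term sequence).** Let $(K,L_K)\overset{i}\to(G,L_G)\overset{p}\to(N,L_N)$ be a short exact sequence of groups with word length, with $G$ countable, and let $M'$ be a p.s. $N$-module, regarded as a p.s. $G$-module and as a p.s. $K$-module via $p$ and $p\circ i$. Then there is an exact sequence of $\mathbb Q$-vector spaces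 $$0\to PH^1(N;M')\xrightarrow{\ \mathrm{inf}\ } PH^1(G;M')\xrightarrow{\ \mathrm{res}\ } PH^0(N;PH^1(K;M'))\xrightarrow{\ \mathrm{tg}\ } PH^2(N;M')\xrightarrow{\ \mathrm{inf}\ } PH^2(G;M').$$ Here $PH^1(K;M')$ carries the following p.s. $N$-module structure: it is identified, by restriction along $K\backslash EK_*\subset K\backslash EG_*$ (an isomorphism), with $\ker\delta^1/\operatorname{im}\delta^0$ of the cocomplex $\mathrm{PHom}(K\backslash EG_*,M')$ (with $M'$ regarded as a p.s. module over the trivial group, and weights $|(\bar g_0,g_1,\dots,g_n)|=1+L_N(\bar g_0)+\sum_{j\ge1} L_G(g_j)$ on the basis $N\times G^n$), on which $N$ acts by $(g\cdot f)(t)=g f(g^{-1}t)$, with the quotient semi-norms $\eta_{(x,U)}([f])=\inf\{\sum_{t\in U}\eta_x(f'(t)) : [f']=[f]\}$ indexed by pairs $(x,U)$, $x\in\Lambda_{M'}$, $U\subset N\times G$ finite, with $g(x,U)=(gx,g^{-1}U)$. The maps $\mathrm{inf}$ are induced by $p$; $\mathrm{res}$ is induced by restriction along $i$, where $PH^0(N;PH^1(K;M'))$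 is embedded in $PH^1(K;M')$ by evaluation of cocycles at $1\in N$; and $\mathrm{tg}$ is the transgression: for every $z$ there are a cocycle $c\in\mathrm{PHom}_N(EN_2,M')$ and a cochain $F\in\mathrm{PHom}_G(EG_1,M')$ such that $F|_K$ is a cocycle representing $z$ and $\delta F=p^*c$, and for all such $c$ one has $\mathrm{tg}(z)=[c]$. -/

import Mathlib

noncomputable section

namespace PBdd

/-! ### Groups with word length -/

/-- A word-length function on a group, with real values (so that the usual `ℕ`-valued ones are
included); it need not be proper. -/
structure WordLength (G : Type*) [Group G] where
  toFun : G → ℝ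
  map_one : toFun 1 = 0
  map_inv : ∀ g, toFun g⁻¹ = toFun g
  map_mul_le : ∀ g h, toFun (g * h) ≤ toFun g + toFun h

instance {G : Type*} [Group G] : CoeFun (WordLength G) (fun _ => G → ℝ) := ⟨WordLength.toFun⟩

theorem WordLength.nonneg {G : Type*} [Group G] (L : WordLength G) (g : G) : 0 ≤ L g := by
  have h := L.map_mul_le g g⁻¹
  rw [mul_inv_cancel, L.map_one, L.map_inv] at h
  linarith

/-- The (only) word-length function on the trivial group. -/
def WordLength.trivial : WordLength Unit where
  toFun _ := 0
  map_one := rfl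
  map_inv _ := rfl
  map_mul_le _ _ := by simp

/-- `f` is a morphism `(G, L) → (G', L')` of groups with word length:
`L' (f g) = min {L h | f h = f g}`. -/
def IsWordLengthHom {G G' : Type*} [Group G] [Group G'] (L : WordLength G) (L' : WordLength G')
    (f : G →* G') : Prop :=
  ∀ g, IsLeast (L '' {h | f h = f g}) (L' (f g))

theorem IsWordLengthHom.le {G G' : Type*} [Group G] [Group G'] {L : WordLength G}
    {L' : WordLength G'} {f : G →* G'} (hf : IsWordLengthHom L L' f) (g : G) :
    L' (f g) ≤ L g :=
  (hf g).2 ⟨g, rfl, rfl⟩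

/-- `(K, L_K) → (G, L_G) → (N, L_N)` is a short exact sequence of groups with word length. -/
structure IsShortExact {K G N : Type*} [Group K] [Group G] [Group N] (LK : WordLength K)
    (LG : WordLength G) (LN : WordLength N) (i : K →* G) (p : G →* N) : Prop where
  hom_left : IsWordLengthHom LK LG i
  hom_right : IsWordLengthHom LG LN p
  injective : Function.Injective i
  surjective : Function.Surjective p
  exact : i.range = p.ker

/-! ### p-semi-normed modules -/

universe w

/-- The structure of a p-semi-normed `G`-module on the `ℚ`-vector space `M`: a linear action `ρ`
of `G` and a family of semi-norms `η x`, indexed by a countable set `Λ` with an action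
`(g, x) ↦ act g x` of `G`. Of the laws of an action only `act 1 x = x` is imposed, so that left
`G`-sets and right `G`-sets (with `act g x = x · g`) are both covered, as are products of the two,
such as the index sets `(x, U) ↦ (g x, g⁻¹ U)` of the semi-norms on spaces of homomorphisms. -/
structure PSModule {G : Type*} [Group G] (L : WordLength G) (M : Type*) [AddCommGroup M]
    [Module ℚ M] where
  ρ : Representation ℚ G M
  Λ : Type w
  countable : Countable Λ
  act : G → Λ → Λ
  one_act : ∀ x, act 1 x = x
  η : Λ → Seminorm ℚ M
  directed : ∀ (n : ℕ) (x : Fin (n + 1) → Λ) (l : Fin (n + 1) → ℕ), (∀ j, 0 < l j) →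
    ∃ (C : ℝ) (y : Λ), ∀ m : M, ∑ j, (l j : ℝ) * η (x j) m ≤ C * η y m
  growth : ∃ (C : ℝ) (n : ℕ), ∀ x' : Λ, ∃ x : Λ, ∀ (g h : G) (m : M),
    η (act g x') (ρ h m) ≤ C * (1 + L h) ^ n * η (act (g * h) x) m

namespace PSModule

variable {G H M : Type*} [Group G] [Group H] [AddCommGroup M] [Module ℚ M]
  {LG : WordLength G} {LH : WordLength H}

/-- A p-semi-normed `H`-module is a p-semi-normed `G`-module via a homomorphism `f : G → H` that
does not increase word length. -/
def comap (S : PSModule.{w} LH M) (f : G →* H) (hf : ∀ g, LH (f g) ≤ LG g) :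
    PSModule.{w} LG M where
  ρ := S.ρ.comp f
  Λ := S.Λ
  countable := S.countable
  act g := S.act (f g)
  one_act x := by rw [map_one, S.one_act]
  η := S.η
  directed := S.directed
  growth := by
    obtain ⟨C, n, h⟩ := S.growth
    refine ⟨|C|, n, fun x' => ?_⟩
    obtain ⟨x, hx⟩ := h x'
    refine ⟨x, fun g k m => ?_⟩
    rw [map_mul]
    refine (hx (f g) (f k) m).trans ?_
    have h0 := LH.nonneg (f k)
    have h1 := hf k
    have h2 := apply_nonneg (S.η (S.act (f g * f k) x)) m
    gcongr
    exact le_abs_self C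

/-- The p-semi-normed module (over the trivial group) underlying a p-semi-normed `G`-module. -/
def forget (S : PSModule.{w} LG M) : PSModule.{w} WordLength.trivial M :=
  S.comap 1 (fun _ => by simp [LG.map_one, WordLength.trivial])

/-- `PHom(P, M)` for the free p-bounded module `P` whose `ℚ`-basis is the weighted set
`T` with weights `w t = |t|`. A linear map `P → M` is identified with the function `T → M` of its
values on the basis. It is p-bounded if, on the basis, it is bounded by a polynomial in the
semi-norm `1 + |t|` of `t` and in the word length, of a degree independent of the
semi-norm of `M`. -/
def PHom (S : PSModule.{w} LG M) {T : Type*} (w : T → ℝ) (hw : ∀ t, 0 ≤ w t) :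
    Submodule ℚ (T → M) where
  carrier := {f | ∃ n : ℕ, ∀ x : S.Λ, ∃ C : ℝ, ∀ (g : G) (t : T),
    S.η (S.act g x) (f t) ≤ C * (1 + (1 + w t)) ^ n * (1 + LG g) ^ n}
  zero_mem' := ⟨0, fun x => ⟨0, fun g t => by simp⟩⟩
  add_mem' := by
    rintro f f' ⟨n, hn⟩ ⟨n', hn'⟩
    refine ⟨n + n', fun x => ?_⟩
    obtain ⟨C, hC⟩ := hn x
    obtain ⟨C', hC'⟩ := hn' x
    refine ⟨|C| + |C'|, fun g t => ?_⟩
    have h1 : (1 : ℝ) ≤ 1 + (1 + w t) := by linarith [hw t]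
    have h2 : (1 : ℝ) ≤ 1 + LG g := by linarith [LG.nonneg g]
    have key : ∀ (D : ℝ) (a : ℕ), a ≤ n + n' →
        D * (1 + (1 + w t)) ^ a * (1 + LG g) ^ a ≤
          |D| * (1 + (1 + w t)) ^ (n + n') * (1 + LG g) ^ (n + n') := by
      intro D a ha
      have h3 := le_abs_self D
      gcongr
    calc S.η (S.act g x) ((f + f') t) ≤ S.η (S.act g x) (f t) + S.η (S.act g x) (f' t) :=
          map_add_le_add _ _ _
      _ ≤ _ := add_le_add ((hC g t).trans (key C n (by omega)))
          ((hC' g t).trans (key C' n' (by omega)))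
      _ = _ := by ring
  smul_mem' := by
    rintro q f ⟨n, hn⟩
    refine ⟨n, fun x => ?_⟩
    obtain ⟨C, hC⟩ := hn x
    refine ⟨‖q‖ * C, fun g t => ?_⟩
    rw [Pi.smul_apply, map_smul_eq_mul, mul_assoc, mul_assoc, ← mul_assoc C]
    exact mul_le_mul_of_nonneg_left (hC g t) (norm_nonneg q)

/-- Transport of structure along a linear isomorphism. -/
def transport {M' : Type*} [AddCommGroup M'] [Module ℚ M'] (S : PSModule.{w} LG M)
    (e : M ≃ₗ[ℚ] M') : PSModule.{w} LG M' where
  ρ :=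
    { toFun := fun g => e.toLinearMap ∘ₗ S.ρ g ∘ₗ e.symm.toLinearMap
      map_one' := by ext m; simp
      map_mul' := fun g g' => by ext m; simp }
  Λ := S.Λ
  countable := S.countable
  act := S.act
  one_act := S.one_act
  η x := (S.η x).comp e.symm.toLinearMap
  directed n x l hl := by
    obtain ⟨C, y, h⟩ := S.directed n x l hl
    exact ⟨C, y, fun m => h (e.symm m)⟩
  growth := by
    obtain ⟨C, n, h⟩ := S.growth
    refine ⟨C, n, fun x' => (h x').imp fun x hx g g' m => ?_⟩
    simpa using hx g g' (e.symm m)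

end PSModule

/-! ### Cohomology of a cocomplex of subspaces -/

section Cohomology

variable {V : ℕ → Type*} [∀ n, AddCommGroup (V n)] [∀ n, Module ℚ (V n)]
  {W : ℕ → Type*} [∀ n, AddCommGroup (W n)] [∀ n, Module ℚ (W n)]

/-- The cocycles lying in the subspaces `C n`. -/
def cocycles (δ : ∀ n, V n →ₗ[ℚ] V (n + 1)) (C : ∀ n, Submodule ℚ (V n)) (n : ℕ) :
    Submodule ℚ (V n) :=
  C n ⊓ LinearMap.ker (δ n)

/-- The coboundaries of elements of the subspaces `C n`. -/
def coboundaries (δ : ∀ n, V n →ₗ[ℚ] V (n + 1)) (C : ∀ n, Submodule ℚ (V n)) :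
    ∀ n, Submodule ℚ (V n)
  | 0 => ⊥
  | n + 1 => (C n).map (δ n)

/-- The cohomology, in degree `n`, of the cocomplex of the subspaces `C n`. -/
abbrev Cohomology (δ : ∀ n, V n →ₗ[ℚ] V (n + 1)) (C : ∀ n, Submodule ℚ (V n)) (n : ℕ) : Type _ :=
  cocycles δ C n ⧸ (coboundaries δ C n).submoduleOf (cocycles δ C n)

variable {δ : ∀ n, V n →ₗ[ℚ] V (n + 1)} {C : ∀ n, Submodule ℚ (V n)}
  {ε : ∀ n, W n →ₗ[ℚ] W (n + 1)} {D : ∀ n, Submodule ℚ (W n)}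

/-- The cohomology class of a cocycle. -/
abbrev Cohomology.mk (n : ℕ) : cocycles δ C n →ₗ[ℚ] Cohomology δ C n := Submodule.mkQ _

theorem map_mem_cocycles (φ : ∀ n, V n →ₗ[ℚ] W n)
    (hδ : ∀ n f, ε n (φ n f) = φ (n + 1) (δ n f)) (hC : ∀ n f, f ∈ C n → φ n f ∈ D n)
    (n : ℕ) (f : V n) (hf : f ∈ cocycles δ C n) : φ n f ∈ cocycles ε D n := by
  refine ⟨hC n f hf.1, ?_⟩
  have h : δ n f = 0 := hf.2
  change ε n (φ n f) = 0
  rw [hδ, h, map_zero]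

theorem map_mem_coboundaries (φ : ∀ n, V n →ₗ[ℚ] W n)
    (hδ : ∀ n f, ε n (φ n f) = φ (n + 1) (δ n f)) (hC : ∀ n f, f ∈ C n → φ n f ∈ D n)
    (n : ℕ) (f : V n) (hf : f ∈ coboundaries δ C n) : φ n f ∈ coboundaries ε D n := by
  cases n with
  | zero =>
    have : f = 0 := hf
    rw [this, map_zero]
    exact Submodule.zero_mem _
  | succ n =>
    obtain ⟨c, hc, rfl⟩ := hf
    exact ⟨φ n c, hC n c hc, hδ n c⟩

/-- The map induced in cohomology by a cochain map `φ`. -/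
def Cohomology.map (φ : ∀ n, V n →ₗ[ℚ] W n)
    (hδ : ∀ n f, ε n (φ n f) = φ (n + 1) (δ n f)) (hC : ∀ n f, f ∈ C n → φ n f ∈ D n) (n : ℕ) :
    Cohomology δ C n →ₗ[ℚ] Cohomology ε D n :=
  Submodule.mapQ _ _ ((φ n).restrict (map_mem_cocycles φ hδ hC n))
    (fun f hf => map_mem_coboundaries φ hδ hC n f.1 hf)

end Cohomology

/-! ### Bar complexes -/

section Bar

variable {G H G' H' : Type*} [Group G] [Group H] [Group G'] [Group H']

/-- The basis `H × Gⁿ` in degree `n` of the bar complex attached to a homomorphism `p : G → H`.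
For `p = id` it is the basis of `(EG)ₙ`; for a surjection `p : G → N` with kernel `K` it is the
basis of `K \ (EG)ₙ`, the first coordinate being a class in `K \ G = N`. -/
abbrev Bar (H G : Type*) (n : ℕ) : Type _ := H × (Fin n → G)

/-- The weight `|(h, g₁, …, gₙ)| = L(h) + (1 + L(g₁) + ⋯ + L(gₙ))`. -/
def barWeight (LH : WordLength H) (LG : WordLength G) (n : ℕ) (t : Bar H G n) : ℝ :=
  LH t.1 + (1 + ∑ j, LG (t.2 j))

theorem barWeight_nonneg (LH : WordLength H) (LG : WordLength G) (n : ℕ) (t : Bar H G n) :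
    0 ≤ barWeight LH LG n t :=
  add_nonneg (LH.nonneg _) (add_nonneg zero_le_one (Finset.sum_nonneg fun _ _ => LG.nonneg _))

variable (M : Type*) [AddCommGroup M] [Module ℚ M]

/-- The coboundary `f ↦ f ∘ d`, where
`d (h, g₁, …, gₙ₊₁) = (h g₁, g₂, …) + ∑_{j=1}^{n} (-1)^j (h, …, gⱼ gⱼ₊₁, …)
  + (-1)^(n+1) (h, g₁, …, gₙ)`
and `h g₁` stands for `h * p g₁`. -/
def barδ (p : G →* H) (n : ℕ) : (Bar H G n → M) →ₗ[ℚ] (Bar H G (n + 1) → M) where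
  toFun f t := f (t.1 * p (t.2 0), Fin.tail t.2) +
    ∑ j : Fin (n + 1), (-1 : ℚ) ^ ((j : ℕ) + 1) • f (t.1, Fin.contractNth j (· * ·) t.2)
  map_add' f f' := by
    funext t
    simp only [Pi.add_apply, smul_add, Finset.sum_add_distrib]
    abel
  map_smul' q f := by
    funext t
    simp only [Pi.smul_apply, RingHom.id_apply, smul_add, Finset.smul_sum]
    congr 1
    exact Finset.sum_congr rfl fun j _ => smul_comm _ _ _

/-- The map of cochains induced by a map `(α, β)` of bar complexes. -/
def barPull (α : H' →* H) (β : G' →* G) (n : ℕ) : (Bar H G n → M) →ₗ[ℚ] (Bar H' G' n → M) :=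
  LinearMap.funLeft ℚ M fun t => (α t.1, β ∘ t.2)

variable {M}

theorem barδ_barPull {p : G →* H} {p' : G' →* H'} {α : H' →* H} {β : G' →* G}
    (hαβ : α.comp p' = p.comp β) (n : ℕ) (f : Bar H G n → M) :
    barδ M p' n (barPull M α β n f) = barPull M α β (n + 1) (barδ M p n f) := by
  funext t
  have h1 : α (p' (t.2 0)) = p (β (t.2 0)) := DFunLike.congr_fun hαβ _
  simp only [barδ, barPull, LinearMap.coe_mk, AddHom.coe_mk, LinearMap.funLeft_apply, map_mul, h1,
    Fin.comp_contractNth (· * ·) (· * ·) (map_mul β)]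
  rfl

theorem barδ_zero (p : G →* H) (f : Bar H G 0 → M) (t : Bar H G 1) :
    barδ M p 0 f t = f (t.1 * p (t.2 0), Fin.elim0) - f (t.1, Fin.elim0) := by
  simp only [barδ, LinearMap.coe_mk, AddHom.coe_mk, Fin.sum_univ_succ, Finset.univ_eq_empty,
    Finset.sum_empty]
  rw [Subsingleton.elim (Fin.tail t.2) Fin.elim0, Subsingleton.elim (Fin.contractNth 0 _ t.2)
    Fin.elim0]
  simp [sub_eq_add_neg]

theorem barδ_one (p : G →* H) (f : Bar H G 1 → M) (h : H) (a b : G) :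
    barδ M p 1 f (h, ![a, b]) =
      f (h * p a, fun _ => b) - f (h, fun _ => a * b) + f (h, fun _ => a) := by
  have e1 : Fin.tail ![a, b] = fun _ => b := by funext j; fin_cases j; rfl
  have e2 : Fin.contractNth 0 (· * ·) ![a, b] = fun _ => a * b := by funext j; fin_cases j; rfl
  have e3 : Fin.contractNth 1 (· * ·) ![a, b] = fun _ => a := by funext j; fin_cases j; rfl
  change f (h * p a, Fin.tail ![a, b]) + ∑ j : Fin 2, (-1 : ℚ) ^ ((j : ℕ) + 1) •
    f (h, Fin.contractNth j (· * ·) ![a, b]) = _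
  rw [Fin.sum_univ_two, e1, e2, e3]
  simp [sub_eq_add_neg, add_assoc]

theorem barWeight_le {LH : WordLength H} {LG : WordLength G} {LH' : WordLength H'}
    {LG' : WordLength G'} {α : H' →* H} {β : G' →* G} (hα : ∀ h, LH (α h) ≤ LH' h)
    (hβ : ∀ g, LG (β g) ≤ LG' g) (n : ℕ) (t : Bar H' G' n) :
    barWeight LH LG n (α t.1, β ∘ t.2) ≤ barWeight LH' LG' n t := by
  unfold barWeight
  gcongr
  · exact hα _
  · exact hβ _

end Bar

/-! ### p-bounded group cohomology -/

section PH

variable {G H M : Type*} [Group G] [Group H] [AddCommGroup M] [Module ℚ M]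
  {LG : WordLength G} {LH : WordLength H}

/-- The p-bounded cochains `PHom_G((EG)ₙ, M)`: the p-bounded equivariant maps. -/
def PC (S : PSModule.{w} LG M) (n : ℕ) : Submodule ℚ (Bar G G n → M) :=
  S.PHom (barWeight LG LG n) (barWeight_nonneg LG LG n) ⊓
  { carrier := {f | ∀ (g : G) (t : Bar G G n), f (g * t.1, t.2) = S.ρ g (f t)}
    zero_mem' := fun g t => by simp
    add_mem' := fun {f f'} hf hf' g t => by
      rw [Pi.add_apply, Pi.add_apply, map_add, hf g t, hf' g t]
    smul_mem' := fun q f hf g t => by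
      rw [Pi.smul_apply, Pi.smul_apply, map_smul, hf g t] }

/-- The cocycles of the cocomplex `PHom_G(EG_*, M)`. -/
abbrev PZ (S : PSModule.{w} LG M) (n : ℕ) : Submodule ℚ (Bar G G n → M) :=
  cocycles (barδ M (MonoidHom.id G)) (PC S) n

/-- The p-bounded cohomology `PHⁿ(G; M)`. -/
abbrev PH (S : PSModule.{w} LG M) (n : ℕ) : Type _ :=
  Cohomology (barδ M (MonoidHom.id G)) (PC S) n

theorem barPull_mem_PC (S : PSModule.{w} LH M) (f : G →* H) (hf : ∀ g, LH (f g) ≤ LG g) (n : ℕ)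
    (c : Bar H H n → M) (hc : c ∈ PC S n) : barPull M f f n c ∈ PC (S.comap f hf) n := by
  obtain ⟨⟨d, hd⟩, hc2⟩ := hc
  refine ⟨⟨d, fun x => ?_⟩, fun g t => ?_⟩
  · obtain ⟨C, hC⟩ := hd x
    refine ⟨|C|, fun g t => ?_⟩
    refine (hC (f g) (f t.1, f ∘ t.2)).trans ?_
    have h1 := barWeight_le hf hf n t
    have h2 := hf g
    have h3 := LH.nonneg (f g)
    have h4 := barWeight_nonneg LH LH n (f t.1, f ∘ t.2)
    have h5 := barWeight_nonneg LG LG n t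
    have h6 := le_abs_self C
    gcongr
  · change c (f (g * t.1), f ∘ t.2) = S.ρ (f g) (c (f t.1, f ∘ t.2))
    rw [map_mul]
    exact hc2 (f g) (f t.1, f ∘ t.2)

/-- The map `PHⁿ(H; M) → PHⁿ(G; M)` induced by a homomorphism `G → H` that does not increase word
length: inflation for surjections, restriction for injections. -/
def PH.map (S : PSModule.{w} LH M) (f : G →* H) (hf : ∀ g, LH (f g) ≤ LG g) (n : ℕ) :
    PH S n →ₗ[ℚ] PH (S.comap f hf) n :=
  Cohomology.map (barPull M f f) (barδ_barPull rfl) (barPull_mem_PC S f hf) n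

/-- The embedding of `PH⁰(G; M)` in `M` that sends the class of an equivariant 0-cocycle
`f : (EG)₀ = ℚ[G] → M` to `f(1)`. -/
def PH.eval (S : PSModule.{w} LG M) : PH S 0 →ₗ[ℚ] M :=
  Submodule.liftQ _ ((LinearMap.proj ((1 : G), Fin.elim0)).comp (PZ S 0).subtype) (by
    intro z hz
    have h : (z : Bar G G 0 → M) = 0 := hz
    simp [h])

end PH

/-! ### The p-semi-normed `N`-module `PH¹(K; M')` -/

section H1

variable {G N M : Type*} [Group G] [Group N] [AddCommGroup M] [Module ℚ M]
  {LG : WordLength G} {LN : WordLength N}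

/-- The p-bounded cochains `PHom(K \ (EG)ₙ, M)`, where `K` is the kernel of `p : G → N` and `M` is
considered as a p-semi-normed module over the trivial group. -/
def QC (LG : WordLength G) (S : PSModule.{w} LN M) (n : ℕ) : Submodule ℚ (Bar N G n → M) :=
  S.forget.PHom (barWeight LN LG n) (barWeight_nonneg LN LG n)

theorem mem_QC {S : PSModule.{w} LN M} {n : ℕ} {f : Bar N G n → M} :
    f ∈ QC LG S n ↔ ∃ d : ℕ, ∀ x : S.Λ, ∃ C : ℝ, ∀ t : Bar N G n,
      S.η x (f t) ≤ C * (1 + (1 + barWeight LN LG n t)) ^ d := by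
  refine exists_congr fun d => forall_congr' fun x => exists_congr fun C => ?_
  have h : ∀ u : Unit, S.forget.act u x = x := fun u => S.forget.one_act x
  simp only [h]
  simp only [PSModule.forget, PSModule.comap, WordLength.trivial, add_zero, one_pow, mul_one]
  exact ⟨fun h => h (), fun h _ => h⟩

/-- The action `(n · f)(t) = n f(n⁻¹ t)` of `N` on `Hom(K \ (EG)_q, M)`. -/
def translate (S : PSModule.{w} LN M) (q : ℕ) (n : N) :
    (Bar N G q → M) →ₗ[ℚ] (Bar N G q → M) where
  toFun f t := S.ρ n (f (n⁻¹ * t.1, t.2))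
  map_add' f f' := by funext t; simp
  map_smul' a f := by funext t; simp

theorem barδ_translate (p : G →* N) (S : PSModule.{w} LN M) (n : N) (q : ℕ) (f : Bar N G q → M) :
    barδ M p q (translate S q n f) = translate S (q + 1) n (barδ M p q f) := by
  funext t
  simp [barδ, translate, mul_assoc]

theorem translate_mem_QC (S : PSModule.{w} LN M) (n : N) (q : ℕ) (f : Bar N G q → M)
    (hf : f ∈ QC LG S q) : translate S q n f ∈ QC LG S q := by
  rw [mem_QC] at hf ⊢
  obtain ⟨d, hd⟩ := hf
  obtain ⟨C, k, hC⟩ := S.growth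
  refine ⟨d, fun x' => ?_⟩
  obtain ⟨x, hx⟩ := hC x'
  obtain ⟨D, hD⟩ := hd (S.act n x)
  refine ⟨|C| * (1 + LN n) ^ k * |D| * (1 + LN n) ^ d, fun t => ?_⟩
  have h0 := LN.nonneg n
  have h1 := hx 1 n (f (n⁻¹ * t.1, t.2))
  rw [S.one_act, one_mul] at h1
  have h2 := hD (n⁻¹ * t.1, t.2)
  have hw := barWeight_nonneg LN LG q (n⁻¹ * t.1, t.2)
  have hw' := barWeight_nonneg LN LG q t
  have h3 : 1 + (1 + barWeight LN LG q (n⁻¹ * t.1, t.2)) ≤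
      (1 + LN n) * (1 + (1 + barWeight LN LG q t)) := by
    have : barWeight LN LG q (n⁻¹ * t.1, t.2) ≤ LN n + barWeight LN LG q t := by
      unfold barWeight
      have := LN.map_mul_le n⁻¹ t.1
      rw [LN.map_inv] at this
      simp only
      linarith
    nlinarith
  calc S.η x' (translate S q n f t) ≤ _ := h1
    _ ≤ |C| * (1 + LN n) ^ k * (|D| * ((1 + LN n) * (1 + (1 + barWeight LN LG q t))) ^ d) := by
        have h4 : S.η (S.act n x) (f (n⁻¹ * t.1, t.2)) ≤
            |D| * ((1 + LN n) * (1 + (1 + barWeight LN LG q t))) ^ d := by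
          refine h2.trans ?_
          gcongr
          exact le_abs_self D
        have h5 := apply_nonneg (S.η (S.act n x)) (f (n⁻¹ * t.1, t.2))
        gcongr
        exact le_abs_self C
    _ = _ := by rw [mul_pow]; ring

variable (LG) in
/-- The first cohomology of the cocomplex `PHom(K \ (EG)_*, M)`. -/
abbrev QH1 (p : G →* N) (S : PSModule.{w} LN M) : Type _ :=
  Cohomology (barδ M p) (QC LG S) 1

variable (LG) in
/-- The action of `N` on the first cohomology of `PHom(K \ (EG)_*, M)`. -/
def QH1.rep (p : G →* N) (S : PSModule.{w} LN M) : Representation ℚ N (QH1 LG p S) where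
  toFun n := Cohomology.map (fun q => translate S q n) (barδ_translate p S n)
    (translate_mem_QC S n) 1
  map_one' := by
    refine LinearMap.ext fun c => ?_
    obtain ⟨z, rfl⟩ := Submodule.mkQ_surjective _ c
    refine congrArg (Cohomology.mk 1) (Subtype.ext ?_)
    funext t
    simp [translate]
  map_mul' n n' := by
    refine LinearMap.ext fun c => ?_
    obtain ⟨z, rfl⟩ := Submodule.mkQ_surjective _ c
    refine congrArg (Cohomology.mk 1) (Subtype.ext ?_)
    funext t
    simp [translate, mul_assoc]

/-- The semi-norm `η_{(x,U)}(f) = ∑_{t ∈ U} η_x(f(t))` on maps. -/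
def sumNorm (S : PSModule.{w} LN M) {T : Type*} (x : S.Λ) (U : Finset T) : Seminorm ℚ (T → M) :=
  Seminorm.of (fun f => ∑ t ∈ U, S.η x (f t))
    (fun f f' => by
      rw [← Finset.sum_add_distrib]
      exact Finset.sum_le_sum fun t _ => map_add_le_add _ _ _)
    (fun q f => by
      simp only [Pi.smul_apply, map_smul_eq_mul, Finset.mul_sum])

theorem sumNorm_apply (S : PSModule.{w} LN M) {T : Type*} (x : S.Λ) (U : Finset T) (f : T → M) :
    sumNorm S x U f = ∑ t ∈ U, S.η x (f t) := rfl

/-- The quotient of a semi-norm `s` on a subspace `Z` of `V`, on a quotient of `Z`: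
the infimum over all representatives. -/
def quotNorm {V : Type*} [AddCommGroup V] [Module ℚ V] (s : Seminorm ℚ V) {Z : Submodule ℚ V}
    (B : Submodule ℚ Z) : Seminorm ℚ (Z ⧸ B) :=
  Seminorm.ofSMulLE (fun c => ⨅ z : {z : Z // B.mkQ z = c}, s (z.1 : V))
    (by
      refine le_antisymm ?_ (Real.iInf_nonneg fun z => apply_nonneg _ _)
      refine (ciInf_le ⟨0, ?_⟩ (⟨0, map_zero _⟩ : {z : Z // B.mkQ z = 0})).trans ?_
      · rintro _ ⟨z, rfl⟩
        exact apply_nonneg _ _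
      · simp)
    (by
      intro c c'
      have : Nonempty {z : Z // B.mkQ z = c} := (Submodule.mkQ_surjective B c).elim fun z hz => ⟨⟨z, hz⟩⟩
      have : Nonempty {z : Z // B.mkQ z = c'} :=
        (Submodule.mkQ_surjective B c').elim fun z hz => ⟨⟨z, hz⟩⟩
      refine le_ciInf_add_ciInf fun z z' => ?_
      refine (ciInf_le ⟨0, ?_⟩ (⟨z.1 + z'.1, by rw [map_add, z.2, z'.2]⟩ :
        {y : Z // B.mkQ y = c + c'})).trans ?_
      · rintro _ ⟨y, rfl⟩
        exact apply_nonneg _ _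
      · exact map_add_le_add s _ _)
    (by
      intro r c
      have : Nonempty {z : Z // B.mkQ z = c} :=
        (Submodule.mkQ_surjective B c).elim fun z hz => ⟨⟨z, hz⟩⟩
      rw [Real.mul_iInf_of_nonneg (norm_nonneg r)]
      refine le_ciInf fun z => ?_
      refine (ciInf_le ⟨0, ?_⟩ (⟨r • z.1, by rw [map_smul, z.2]⟩ :
        {y : Z // B.mkQ y = r • c})).trans ?_
      · rintro _ ⟨y, rfl⟩
        exact apply_nonneg _ _
      · exact (map_smul_eq_mul s r (z.1 : V)).le)

theorem quotNorm_apply {V : Type*} [AddCommGroup V] [Module ℚ V] (s : Seminorm ℚ V)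
    {Z : Submodule ℚ V} (B : Submodule ℚ Z) (c : Z ⧸ B) :
    quotNorm s B c = ⨅ z : {z : Z // B.mkQ z = c}, s (z.1 : V) := rfl

theorem quotNorm_le {V : Type*} [AddCommGroup V] [Module ℚ V] (s : Seminorm ℚ V)
    {Z : Submodule ℚ V} (B : Submodule ℚ Z) (z : Z) : quotNorm s B (B.mkQ z) ≤ s (z : V) :=
  ciInf_le (f := fun y : {y : Z // B.mkQ y = B.mkQ z} => s (y.1 : V))
    ⟨0, by rintro _ ⟨y, rfl⟩; exact apply_nonneg _ _⟩ ⟨z, rfl⟩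

theorem le_mul_quotNorm {V : Type*} [AddCommGroup V] [Module ℚ V] (s : Seminorm ℚ V)
    {Z : Submodule ℚ V} (B : Submodule ℚ Z) (a C : ℝ) (hC : 0 ≤ C) (c : Z ⧸ B)
    (h : ∀ z : Z, B.mkQ z = c → a ≤ C * s (z : V)) : a ≤ C * quotNorm s B c := by
  have : Nonempty {z : Z // B.mkQ z = c} :=
    (Submodule.mkQ_surjective B c).elim fun z hz => ⟨⟨z, hz⟩⟩
  rw [quotNorm_apply, Real.mul_iInf_of_nonneg hC]
  exact le_ciInf fun z => h z.1 z.2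

/-- Left translation of a finite set of basis elements. -/
def shift {X : Type*} (n : N) (U : Finset (N × X)) : Finset (N × X) :=
  U.map ⟨fun t => (n * t.1, t.2), fun t t' h => by
    simp only [Prod.mk.injEq, mul_right_inj] at h
    exact Prod.ext h.1 h.2⟩

theorem sumNorm_shift (S : PSModule.{w} LN M) {X : Type*} (x : S.Λ) (n : N) (U : Finset (N × X))
    (f : N × X → M) :
    sumNorm S x (shift n U) f = ∑ t ∈ U, S.η x (f (n * t.1, t.2)) := by
  rw [sumNorm_apply, shift, Finset.sum_map]
  rfl

variable (LG) in
/-- The first cohomology of `PHom(K \ (EG)_*, M)` as a p-semi-normed `N`-module, with the quotient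
semi-norms of the semi-norms `η_{(x,U)}` on the cocycles; the index `(x, U)` consists of an index
`x` of a semi-norm on `M` and a finite set `U` of basis elements of `K \ (EG)₁`, and
`g (x, U) = (g x, g⁻¹ U)`. -/
def QH1.ps [Countable G] [Countable N] (p : G →* N) (S : PSModule.{w} LN M) :
    PSModule LN (QH1 LG p S) where
  ρ := QH1.rep LG p S
  Λ := S.Λ × Finset (Bar N G 1)
  countable := by
    have := S.countable
    infer_instance
  act g y := (S.act g y.1, shift g⁻¹ y.2)
  one_act y := by
    refine Prod.ext (S.one_act _) (Finset.ext fun t => ?_)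
    simp [shift]
  η y := quotNorm (sumNorm S y.1 y.2) _
  directed := by
    classical
    intro n y l hl
    obtain ⟨C, x, hx⟩ := S.directed n (fun j => (y j).1) l hl
    refine ⟨|C|, (x, Finset.univ.biUnion fun j => (y j).2), fun c => ?_⟩
    refine le_mul_quotNorm _ _ _ _ (abs_nonneg C) c fun z hz => ?_
    calc ∑ j, (l j : ℝ) * quotNorm (sumNorm S (y j).1 (y j).2) _ c
        ≤ ∑ j, (l j : ℝ) * ∑ t ∈ Finset.univ.biUnion fun j => (y j).2,
            S.η (y j).1 ((z : Bar N G 1 → M) t) := by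
          refine Finset.sum_le_sum fun j _ => mul_le_mul_of_nonneg_left ?_ (Nat.cast_nonneg _)
          rw [← hz]
          refine (quotNorm_le _ _ z).trans ?_
          rw [sumNorm_apply]
          exact Finset.sum_le_sum_of_subset_of_nonneg
            (Finset.subset_biUnion_of_mem (fun j => (y j).2) (Finset.mem_univ j))
            fun _ _ _ => apply_nonneg _ _
      _ = ∑ t ∈ Finset.univ.biUnion fun j => (y j).2,
            ∑ j, (l j : ℝ) * S.η (y j).1 ((z : Bar N G 1 → M) t) := by
          simp only [Finset.mul_sum]
          exact Finset.sum_comm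
      _ ≤ ∑ t ∈ Finset.univ.biUnion fun j => (y j).2, |C| * S.η x ((z : Bar N G 1 → M) t) := by
          refine Finset.sum_le_sum fun t _ => (hx _).trans ?_
          exact mul_le_mul_of_nonneg_right (le_abs_self C) (apply_nonneg _ _)
      _ = |C| * sumNorm S x _ (z : Bar N G 1 → M) := by
          rw [sumNorm_apply, Finset.mul_sum]
  growth := by
    obtain ⟨C, d, h⟩ := S.growth
    refine ⟨|C|, d, fun y' => ?_⟩
    obtain ⟨x, hx⟩ := h y'.1
    refine ⟨(x, y'.2), fun g n c => ?_⟩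
    have h0 := LN.nonneg n
    refine le_mul_quotNorm _ _ _ _ (by positivity) c fun z hz => ?_
    have h1 : QH1.rep LG p S n c = Submodule.mkQ _ ⟨translate S 1 n z, map_mem_cocycles
        (fun q => translate S q n) (barδ_translate p S n) (translate_mem_QC S n) 1 _ z.2⟩ := by
      rw [← hz]
      rfl
    rw [h1]
    refine (quotNorm_le _ _ _).trans ?_
    rw [sumNorm_shift, sumNorm_shift, Finset.mul_sum]
    refine Finset.sum_le_sum fun t _ => ?_
    have h2 := hx g n ((z : Bar N G 1 → M) ((g * n)⁻¹ * t.1, t.2))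
    have h3 := apply_nonneg (S.η (S.act (g * n) x)) ((z : Bar N G 1 → M) ((g * n)⁻¹ * t.1, t.2))
    have h4 := le_abs_self C
    have e : translate S 1 n (z : Bar N G 1 → M) (g⁻¹ * t.1, t.2) =
        S.ρ n ((z : Bar N G 1 → M) ((g * n)⁻¹ * t.1, t.2)) := by
      rw [mul_inv_rev, mul_assoc]
      rfl
    change S.η (S.act g y'.1) (translate S 1 n (z : Bar N G 1 → M) (g⁻¹ * t.1, t.2)) ≤
      |C| * (1 + LN n) ^ d * S.η (S.act (g * n) x) ((z : Bar N G 1 → M) ((g * n)⁻¹ * t.1, t.2))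
    rw [e]
    refine h2.trans ?_
    gcongr

end H1

namespace IsShortExact

variable {K G N M : Type*} [Group K] [Group G] [Group N] [AddCommGroup M] [Module ℚ M]
  {LK : WordLength K} {LG : WordLength G} {LN : WordLength N} {i : K →* G} {p : G →* N}

/-- `M'` as a p-semi-normed `G`-module. -/
abbrev psG (h : IsShortExact LK LG LN i p) (S : PSModule.{w} LN M) : PSModule.{w} LG M :=
  S.comap p h.hom_right.le

/-- `M'` as a p-semi-normed `K`-module. -/
abbrev psK (h : IsShortExact LK LG LN i p) (S : PSModule.{w} LN M) : PSModule.{w} LK M :=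
  (h.psG S).comap i h.hom_left.le

theorem p_i (h : IsShortExact LK LG LN i p) (k : K) : p (i k) = 1 := by
  have : i k ∈ p.ker := h.exact ▸ ⟨k, rfl⟩
  exact this

theorem lift (h : IsShortExact LK LG LN i p) {g : G} (hg : p g = 1) : ∃ k, i k = g := by
  have : g ∈ i.range := by rw [h.exact]; exact hg
  exact this

theorem length_left (h : IsShortExact LK LG LN i p) (k : K) : LG (i k) = LK k := by
  obtain ⟨k', hk', e⟩ := (h.hom_left k).1
  rw [← e, h.injective hk']

theorem exists_section (h : IsShortExact LK LG LN i p) (n : N) : ∃ g, p g = n ∧ LG g = LN n := by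
  obtain ⟨g, rfl⟩ := h.surjective n
  obtain ⟨g', hg', e⟩ := (h.hom_right g).1
  exact ⟨g', hg', e⟩

theorem pull_mem_PC (h : IsShortExact LK LG LN i p) (S : PSModule.{w} LN M) (n : ℕ)
    (f : Bar N G n → M) (hf : f ∈ QC LG S n) :
    barPull M (p.comp i) i n f ∈ PC (h.psK S) n := by
  have hpi := h.p_i
  rw [mem_QC] at hf
  obtain ⟨d, hd⟩ := hf
  refine ⟨⟨d, fun x => ?_⟩, fun k t => ?_⟩
  · obtain ⟨C, hC⟩ := hd x
    refine ⟨|C|, fun k t => ?_⟩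
    have e : (h.psK S).act k x = x := by
      exact (congrArg (fun n => S.act n x) (hpi k)).trans (S.one_act x)
    rw [e]
    refine (hC _).trans ?_
    have h1 : barWeight LN LG n ((p.comp i) t.1, i ∘ t.2) ≤ barWeight LK LK n t :=
      barWeight_le (fun k => (h.hom_right.le (i k)).trans (h.hom_left.le k)) h.hom_left.le n t
    have h2 := barWeight_nonneg LN LG n ((p.comp i) t.1, i ∘ t.2)
    have h3 := LK.nonneg k
    have h4 : (1 : ℝ) ≤ (1 + LK k) ^ d := one_le_pow₀ (by linarith)
    have h5 : C * (1 + (1 + barWeight LN LG n ((p.comp i) t.1, i ∘ t.2))) ^ d ≤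
        |C| * (1 + (1 + barWeight LK LK n t)) ^ d := by
      gcongr
      exact le_abs_self C
    have h6 := barWeight_nonneg LK LK n t
    exact h5.trans (le_mul_of_one_le_right (by positivity) h4)
  · change f (p (i (k * t.1)), i ∘ t.2) = S.ρ (p (i k)) (f (p (i t.1), i ∘ t.2))
    simp [hpi]

/-- The map from the first cohomology of `PHom(K \ (EG)_*, M')` to
`PH¹(K; M') = H¹(PHom_K(EK_*, M'))` induced by the inclusion `K \ EK_* ⊂ K \ EG_*`. -/
def compare (h : IsShortExact LK LG LN i p) (S : PSModule.{w} LN M) :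
    QH1 LG p S →ₗ[ℚ] PH (h.psK S) 1 :=
  Cohomology.map (barPull M (p.comp i) i) (barδ_barPull rfl) (h.pull_mem_PC S) 1

theorem psK_ρ (h : IsShortExact LK LG LN i p) (S : PSModule.{w} LN M) (k : K) (m : M) :
    (h.psK S).ρ k m = m := by
  change S.ρ (p (i k)) m = m
  rw [h.p_i, map_one]
  rfl

theorem PC_apply (h : IsShortExact LK LG LN i p) (S : PSModule.{w} LN M) {n : ℕ}
    {f : Bar K K n → M} (hf : f ∈ PC (h.psK S) n) (k : K) (t : Fin n → K) :
    f (k, t) = f (1, t) := by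
  have := hf.2 k (1, t)
  rw [h.psK_ρ] at this
  simpa using this

theorem coboundaries_psK (h : IsShortExact LK LG LN i p) (S : PSModule.{w} LN M) :
    coboundaries (barδ M (MonoidHom.id K)) (PC (h.psK S)) 1 = ⊥ := by
  rw [eq_bot_iff]
  rintro _ ⟨c, hc, rfl⟩
  change _ = _
  funext t
  rw [barδ_zero, h.PC_apply S hc, h.PC_apply S hc t.1]
  simp

theorem compare_injective (h : IsShortExact LK LG LN i p) (S : PSModule.{w} LN M) :
    Function.Injective (h.compare S) := by
  rw [injective_iff_map_eq_zero]
  intro c hc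
  obtain ⟨z, rfl⟩ := Submodule.mkQ_surjective _ c
  have hz : barPull M (p.comp i) i 1 (z : Bar N G 1 → M) ∈ PZ (h.psK S) 1 :=
    map_mem_cocycles (barPull M (p.comp i) i)
      (fun n f => barδ_barPull (p := p) (p' := MonoidHom.id K) rfl n f) (h.pull_mem_PC S) 1 _ z.2
  have h0 : Cohomology.mk (δ := barδ M (MonoidHom.id K)) (C := PC (h.psK S)) 1 ⟨_, hz⟩ = 0 := hc
  have h0' := (Submodule.Quotient.mk_eq_zero _).1 h0
  have h1 : barPull M (p.comp i) i 1 (z : Bar N G 1 → M) ∈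
      coboundaries (barδ M (MonoidHom.id K)) (PC (h.psK S)) 1 := h0'
  rw [h.coboundaries_psK S] at h1
  obtain ⟨f, hf, hδ⟩ := z
  have hK : ∀ k, f (1, fun _ => i k) = 0 := by
    intro k
    have := congrFun (show barPull M (p.comp i) i 1 f = 0 from h1) (1, fun _ => k)
    simpa [barPull, LinearMap.funLeft_apply, Function.comp_def] using this
  have hcoc : ∀ n a b, f (n, fun _ => a * b) = f (n * p a, fun _ => b) + f (n, fun _ => a) := by
    intro n a b
    have := congrFun (show barδ M p 1 f = 0 from hδ) (n, ![a, b])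
    rw [barδ_one] at this
    exact (sub_eq_zero.1 (by rw [Pi.zero_apply] at this; rw [← this]; abel)).symm
  choose s hs hsL using h.exists_section
  refine (Submodule.Quotient.mk_eq_zero _).2 ?_
  change f ∈ coboundaries (barδ M p) (QC LG S) 1
  refine ⟨fun t => f (1, fun _ => s t.1), ?_, ?_⟩
  · rw [SetLike.mem_coe, mem_QC]
    obtain ⟨d, hd⟩ := mem_QC.1 hf
    refine ⟨d, fun x => ?_⟩
    obtain ⟨C, hC⟩ := hd x
    refine ⟨C, fun t => ?_⟩
    have := hC (1, fun _ => s t.1)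
    have e : barWeight LN LG 1 (1, fun _ => s t.1) = barWeight LN LG 0 t := by
      simp [barWeight, LN.map_one, hsL]
      ring
    rwa [e] at this
  · funext t
    obtain ⟨n, g⟩ := t
    obtain ⟨a, rfl⟩ : ∃ a, g = fun _ => a := ⟨g 0, funext fun j => by fin_cases j; rfl⟩
    rw [barδ_zero]
    obtain ⟨k, hk⟩ := h.lift (g := s n * a * (s (n * p a))⁻¹) (by simp [hs])
    have e1 := hcoc 1 (s n) a
    have e2 := hcoc 1 (i k) (s (n * p a))
    rw [hk, inv_mul_cancel_right, ← hk, h.p_i, hK, add_zero, mul_one] at e2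
    rw [one_mul, hs] at e1
    simp only
    rw [← e2, e1, add_sub_cancel_right]

theorem compare_surjective (h : IsShortExact LK LG LN i p) (S : PSModule.{w} LN M) :
    Function.Surjective (h.compare S) := by
  intro c
  obtain ⟨⟨φ, hφ, hδ⟩, rfl⟩ := Submodule.mkQ_surjective _ c
  choose s hs hsL using h.exists_section
  have hl : ∀ (n : N) (g : G), ∃ k, i k = s n * g * (s (n * p g))⁻¹ := fun n g =>
    h.lift (by simp [hs])
  choose κ hκ using hl
  have hmul : ∀ a b, φ (1, fun _ => a * b) = φ (1, fun _ => a) + φ (1, fun _ => b) := by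
    intro a b
    have := congrFun (show barδ M (MonoidHom.id K) 1 φ = 0 from hδ) (1, ![a, b])
    rw [barδ_one, h.PC_apply S hφ] at this
    exact (sub_eq_zero.1 (by rw [Pi.zero_apply] at this; rw [← this]; abel)).symm
  have hconj : ∀ a b, φ (1, fun _ => a * b * a⁻¹) = φ (1, fun _ => b) := by
    intro a b
    have h1 := hmul (a * b * a⁻¹) a
    rw [inv_mul_cancel_right, hmul, add_comm] at h1
    exact (add_right_cancel h1).symm
  let f : Bar N G 1 → M := fun t => φ (1, fun _ => κ t.1 (t.2 0))
  have hf : f ∈ QC LG S 1 := by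
    rw [mem_QC]
    obtain ⟨d, hd⟩ := hφ.1
    refine ⟨d, fun x => ?_⟩
    obtain ⟨C, hC⟩ := hd x
    refine ⟨|C| * 2 ^ d, fun t => ?_⟩
    have h1 : S.η (S.act (p (i 1)) x) (f t) ≤
        C * (1 + (1 + barWeight LK LK 1 (1, fun _ => κ t.1 (t.2 0)))) ^ d * (1 + LK 1) ^ d :=
      hC 1 (1, fun _ => κ t.1 (t.2 0))
    rw [h.p_i, S.one_act, LK.map_one, add_zero, one_pow, mul_one] at h1
    have h2 : LK (κ t.1 (t.2 0)) ≤ 2 * LN t.1 + 2 * LG (t.2 0) := by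
      rw [← h.length_left, hκ]
      have e1 := LG.map_mul_le (s t.1 * t.2 0) (s (t.1 * p (t.2 0)))⁻¹
      have e2 := LG.map_mul_le (s t.1) (t.2 0)
      have e3 := LN.map_mul_le t.1 (p (t.2 0))
      have e4 := h.hom_right.le (t.2 0)
      rw [LG.map_inv, hsL] at e1
      rw [hsL] at e2
      linarith
    have h3 : 1 + (1 + barWeight LK LK 1 (1, fun _ => κ t.1 (t.2 0))) ≤
        2 * (1 + (1 + barWeight LN LG 1 t)) := by
      simp only [barWeight, LK.map_one, Finset.univ_unique, Fin.default_eq_zero,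
        Finset.sum_singleton]
      linarith
    have h4 := barWeight_nonneg LK LK 1 (1, fun _ => κ t.1 (t.2 0))
    have h5 := le_abs_self C
    refine h1.trans ?_
    rw [mul_assoc, ← mul_pow]
    gcongr
  have hfδ : barδ M p 1 f = 0 := by
    funext t
    obtain ⟨n, g⟩ := t
    obtain ⟨a, b, rfl⟩ : ∃ a b, g = ![a, b] :=
      ⟨g 0, g 1, funext fun j => by fin_cases j <;> rfl⟩
    rw [barδ_one]
    have e : κ n (a * b) = κ n a * κ (n * p a) b := by
      apply h.injective
      rw [map_mul, hκ, hκ, hκ, map_mul, mul_assoc n]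
      group
    change φ (1, fun _ => κ (n * p a) b) - φ (1, fun _ => κ n (a * b)) + φ (1, fun _ => κ n a) = 0
    rw [e, hmul]
    abel
  refine ⟨Submodule.mkQ _ ⟨f, hf, hfδ⟩, congrArg (Cohomology.mk 1) (Subtype.ext ?_)⟩
  funext t
  obtain ⟨k, g⟩ := t
  obtain ⟨b, rfl⟩ : ∃ b, g = fun _ => b := ⟨g 0, funext fun j => by fin_cases j; rfl⟩
  change φ (1, fun _ => κ (p (i k)) (i b)) = φ (k, fun _ => b)
  rw [h.PC_apply S hφ k]
  obtain ⟨a, ha⟩ := h.lift (hs 1)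
  have e : κ (p (i k)) (i b) = a * b * a⁻¹ := by
    apply h.injective
    rw [hκ, h.p_i, h.p_i, mul_one, map_mul, map_mul, map_inv, ha]
  rw [e, hconj]

theorem compare_bijective (h : IsShortExact LK LG LN i p) (S : PSModule.{w} LN M) :
    Function.Bijective (h.compare S) :=
  ⟨h.compare_injective S, h.compare_surjective S⟩

/-- `PH¹(K; M')` as a p-semi-normed `N`-module: the structure of the first cohomology of
`PHom(K \ (EG)_*, M')`, carried over along the canonical isomorphism. -/
def psH1 [Countable G] (h : IsShortExact LK LG LN i p) (S : PSModule.{w} LN M) :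
    PSModule LN (PH (h.psK S) 1) :=
  have : Countable N := h.surjective.countable
  (QH1.ps LG p S).transport (LinearEquiv.ofBijective (h.compare S) (h.compare_bijective S))

/-- The class `z ∈ PH⁰(N; PH¹(K; M'))` transgresses to the cocycle `c ∈ PHom_N(EN₂, M')`: there is
a p-bounded cochain `F ∈ PHom_G(EG₁, M')` whose restriction to `K` is a cocycle representing `z`
and whose coboundary is the inflation of `c`. -/
def Transgresses [Countable G] (h : IsShortExact LK LG LN i p) (S : PSModule.{w} LN M)
    (z : PH (h.psH1 S) 0) (c : PZ S 2) : Prop :=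
  ∃ (F : Bar G G 1 → M) (_ : F ∈ PC (h.psG S) 1) (hF : barPull M i i 1 F ∈ PZ (h.psK S) 1),
    PH.eval (h.psH1 S) z =
      Cohomology.mk (δ := barδ M (MonoidHom.id K)) (C := PC (h.psK S)) 1 ⟨_, hF⟩ ∧
    barδ M (MonoidHom.id G) 1 F = barPull M p p 2 (c : Bar N N 2 → M)

end IsShortExact

end PBdd

end

/-! Write `F(g)` for the value `F (1, g)` that determines an equivariant 1-cochain. `K` acts
trivially on `M'`, so `PH¹(K; M')` has no coboundaries and consists of p-bounded homomorphisms `φ :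
K → M'` (`mk_psK_eq_iff`). By `PH.eval`, the middle term is the space of `N`-invariant ones: those
with `φ(gkg⁻¹) = p(g) φ(k)` (`psH1_ρ_mk_eq_iff`).

Everything rests on cochains `F` of `G` whose coboundary is inflated from `N`, so that `p(a) F(b) -
F(ab) + F(a)` depends only on `p(a)` and `p(b)`. If `F` restricts to a cocycle on `K`, its class
there is invariant (`exists_eval_eq_restrict`), and if `F` vanishes on `K`, it is itself inflated
(`exists_barPull_eq`). The case `δF = 0` gives restriction and exactness at `PH¹(G; M')`; the
general case gives uniqueness of the transgression.

For existence, a length-preserving section `s` with `s(1) = 1` extends an invariant `φ` to `F(g) =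
φ(g s(p g)⁻¹)`, whose coboundary is the inflation of minus `φ` applied to the factor set of `s`.

The estimates need two facts. A cochain of `N` is p-bounded as soon as its inflation is, because
elements of `N` have lifts of the same length (`mem_PC_of_barPull_mem`). The extension `F` is
p-bounded (`extend_mem_PC`), although `φ` is bounded only for each fixed semi-norm, without
uniformity along `N`-orbits of indices: invariance trades translating the index for conjugating the
argument of `φ`, at polynomial cost. -/

namespace PBdd

universe w

/-! ### Bar cochains in degrees 1 and 2 -/

section Bar

theorem bar_one_ext {X G M : Type*} {f f' : Bar X G 1 → M}
    (h : ∀ x a, f (x, fun _ => a) = f' (x, fun _ => a)) : f = f' := by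
  funext ⟨x, t⟩
  obtain ⟨a, rfl⟩ : ∃ a, t = fun _ => a := ⟨t 0, funext fun j => by fin_cases j; rfl⟩
  exact h x a

theorem bar_two_ext {X G M : Type*} {f f' : Bar X G 2 → M}
    (h : ∀ x a b, f (x, ![a, b]) = f' (x, ![a, b])) : f = f' := by
  funext ⟨x, t⟩
  obtain ⟨a, b, rfl⟩ : ∃ a b, t = ![a, b] :=
    ⟨t 0, t 1, funext fun j => by fin_cases j <;> rfl⟩
  exact h x a b

variable {G H M : Type*} [Group G] [Group H] [AddCommGroup M] [Module ℚ M]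

/-- All three faces coincide here. This reads off the value of a 1-cochain at the identity from its
coboundary, which is how cochains get normalised below. -/
theorem barδ_one_apply_one (p : G →* H) (f : Bar H G 1 → M) (h : H) :
    barδ M p 1 f (h, ![1, 1]) = f (h, fun _ => 1) := by
  rw [barδ_one]
  simp

theorem barδ_two (p : G →* H) (f : Bar H G 2 → M) (h : H) (a b c : G) :
    barδ M p 2 f (h, ![a, b, c]) =
      f (h * p a, ![b, c]) - f (h, ![a * b, c]) + f (h, ![a, b * c]) - f (h, ![a, b]) := by
  have e1 : Fin.tail ![a, b, c] = ![b, c] := by funext j; fin_cases j <;> rfl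
  have e2 : Fin.contractNth 0 (· * ·) ![a, b, c] = ![a * b, c] := by
    funext j; fin_cases j <;> rfl
  have e3 : Fin.contractNth 1 (· * ·) ![a, b, c] = ![a, b * c] := by
    funext j; fin_cases j <;> rfl
  have e4 : Fin.contractNth 2 (· * ·) ![a, b, c] = ![a, b] := by
    funext j; fin_cases j <;> rfl
  change f (h * p a, Fin.tail ![a, b, c]) + ∑ j : Fin 3, (-1 : ℚ) ^ ((j : ℕ) + 1) •
    f (h, Fin.contractNth j (· * ·) ![a, b, c]) = _
  rw [Fin.sum_univ_three, e1, e2, e3, e4]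
  simp [sub_eq_add_neg, add_assoc, pow_succ]

theorem barδ_two_barδ_one (p : G →* H) (f : Bar H G 1 → M) :
    barδ M p 2 (barδ M p 1 f) = 0 := by
  funext ⟨x, t⟩
  obtain ⟨a, b, c, rfl⟩ : ∃ a b c, t = ![a, b, c] :=
    ⟨t 0, t 1, t 2, funext fun j => by fin_cases j <;> rfl⟩
  simp only [barδ_two, barδ_one, map_mul, mul_assoc, Pi.zero_apply]
  abel

theorem barPull_one_apply {G' H' : Type*} [Group G'] [Group H'] (α : H' →* H) (β : G' →* G)
    (f : Bar H G 1 → M) (x : H') (a : G') :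
    barPull M α β 1 f (x, fun _ => a) = f (α x, fun _ => β a) := rfl

theorem barPull_two_apply {G' H' : Type*} [Group G'] [Group H'] (α : H' →* H) (β : G' →* G)
    (f : Bar H G 2 → M) (x : H') (a b : G') :
    barPull M α β 2 f (x, ![a, b]) = f (α x, ![β a, β b]) := by
  have : β ∘ ![a, b] = ![β a, β b] := by funext j; fin_cases j <;> rfl
  rw [← this]
  rfl

/-- Used to check identities between cochains of `N` after inflation to `G`. -/
theorem barPull_injective {G' H' : Type*} [Group G'] [Group H'] {α : H' →* H} {β : G' →* G}
    (hα : Function.Surjective α) (hβ : Function.Surjective β) (n : ℕ) :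
    Function.Injective (barPull M α β n) := by
  refine LinearMap.funLeft_injective_of_surjective ℚ M _ ?_
  rintro ⟨x, t⟩
  obtain ⟨y, rfl⟩ := hα x
  choose u hu using fun j => hβ (t j)
  exact ⟨(y, u), Prod.ext rfl (funext hu)⟩

end Bar

/-! ### p-bounded cochains, and `PH⁰` as invariants -/

section PHom

variable {G M : Type*} [Group G] [AddCommGroup M] [Module ℚ M] {LG : WordLength G}

theorem PSModule.PHom_comp (S : PSModule.{w} LG M) {T T' : Type*} {w : T → ℝ} {w' : T' → ℝ}
    {hw : ∀ t, 0 ≤ w t} {hw' : ∀ t, 0 ≤ w' t} {f : T → M} (hf : f ∈ S.PHom w hw) (φ : T' → T)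
    (hφ : ∀ t, w (φ t) ≤ w' t) : (fun t => f (φ t)) ∈ S.PHom w' hw' := by
  obtain ⟨d, hd⟩ := hf
  refine ⟨d, fun x => ?_⟩
  obtain ⟨C, hC⟩ := hd x
  refine ⟨|C|, fun g t => (hC g (φ t)).trans ?_⟩
  have h1 := hφ t
  have h2 := hw (φ t)
  have h3 := LG.nonneg g
  have h4 := le_abs_self C
  have h5 := hw' t
  gcongr

theorem PC_apply_mul {S : PSModule.{w} LG M} {n : ℕ} {f : Bar G G n → M} (hf : f ∈ PC S n)
    (g h : G) (t : Fin n → G) : f (g * h, t) = S.ρ g (f (h, t)) :=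
  hf.2 g (h, t)

theorem PC_apply_eq {S : PSModule.{w} LG M} {n : ℕ} {f : Bar G G n → M} (hf : f ∈ PC S n)
    (g : G) (t : Fin n → G) : f (g, t) = S.ρ g (f (1, t)) := by
  rw [← PC_apply_mul hf, mul_one]

/-- By subadditivity of the length, no face map increases weights. -/
theorem barδ_one_mem_PC {S : PSModule.{w} LG M} {f : Bar G G 1 → M} (hf : f ∈ PC S 1) :
    barδ M (MonoidHom.id G) 1 f ∈ PC S 2 := by
  refine ⟨?_, ?_⟩
  · have e : barδ M (MonoidHom.id G) 1 f = (fun t : Bar G G 2 => f (t.1 * t.2 0, fun _ => t.2 1)) -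
        (fun t : Bar G G 2 => f (t.1, fun _ => t.2 0 * t.2 1)) +
        (fun t : Bar G G 2 => f (t.1, fun _ => t.2 0)) := by
      refine bar_two_ext fun x a b => ?_
      rw [barδ_one]
      rfl
    rw [e]
    refine Submodule.add_mem _ (Submodule.sub_mem _ ?_ ?_) ?_ <;>
      refine S.PHom_comp hf.1 _ fun t => ?_ <;>
      simp only [barWeight, Fin.sum_univ_two, Finset.univ_unique, Finset.sum_const,
        Finset.card_singleton, one_smul]
    · linarith [LG.map_mul_le t.1 (t.2 0)]
    · linarith [LG.map_mul_le (t.2 0) (t.2 1)]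
    · linarith [LG.nonneg (t.2 1)]
  · rintro g ⟨x, t⟩
    obtain ⟨a, b, rfl⟩ : ∃ a b, t = ![a, b] :=
      ⟨t 0, t 1, funext fun j => by fin_cases j <;> rfl⟩
    change barδ M (MonoidHom.id G) 1 f (g * x, ![a, b]) =
      S.ρ g (barδ M (MonoidHom.id G) 1 f (x, ![a, b]))
    simp only [barδ_one, MonoidHom.id_apply, mul_assoc, PC_apply_mul hf, map_add, map_sub]

/-- The elements of `PH⁰(G; M)` are the invariants of `M`. -/
theorem PH.ρ_eval (S : PSModule.{w} LG M) (g : G) (z : PH S 0) :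
    S.ρ g (PH.eval S z) = PH.eval S z := by
  obtain ⟨⟨f, hf, hδ⟩, rfl⟩ := Submodule.mkQ_surjective _ z
  change S.ρ g (f (1, Fin.elim0)) = f (1, Fin.elim0)
  have := congrFun (show barδ M (MonoidHom.id G) 0 f = 0 from hδ) (1, fun _ => g)
  rw [barδ_zero] at this
  rw [← PC_apply_mul hf, mul_one]
  simpa [sub_eq_zero] using this

/-- Equivariance determines a 0-cochain by its value at the identity, and degree 0 has no
coboundaries to divide by. -/
theorem PH.eval_injective (S : PSModule.{w} LG M) : Function.Injective (PH.eval S) := by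
  rw [injective_iff_map_eq_zero]
  intro z hz
  obtain ⟨⟨f, hf, hδ⟩, rfl⟩ := Submodule.mkQ_surjective _ z
  have h1 : f (1, Fin.elim0) = 0 := hz
  refine (Submodule.Quotient.mk_eq_zero _).2 ?_
  change f = 0
  funext ⟨g, t⟩
  rw [PC_apply_eq hf, Subsingleton.elim t Fin.elim0, h1, map_zero]
  rfl

/-- The constant cochain at an invariant element is a cocycle; the growth axiom makes it p-bounded
automatically. -/
theorem PH.exists_eval_eq (S : PSModule.{w} LG M) {m : M} (hm : ∀ g, S.ρ g m = m) :
    ∃ z, PH.eval S z = m := by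
  have hf : (fun _ => m) ∈ PC S 0 := by
    refine ⟨?_, fun g t => (hm g).symm⟩
    obtain ⟨C, d, hC⟩ := S.growth
    refine ⟨d, fun x' => ?_⟩
    obtain ⟨x, hx⟩ := hC x'
    refine ⟨|C| * S.η x m, fun g t => ?_⟩
    -- Acting by `g⁻¹` moves the index `g * g⁻¹` back to `1`, so the right-hand semi-norm no longer
    -- depends on `g`.
    have h1 := hx g g⁻¹ m
    rw [hm, mul_inv_cancel, S.one_act, LG.map_inv] at h1
    have h2 := barWeight_nonneg LG LG 0 t
    have h3 := LG.nonneg g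
    have h4 := apply_nonneg (S.η x) m
    have h5 : (1 : ℝ) ≤ (1 + (1 + barWeight LG LG 0 t)) ^ d := one_le_pow₀ (by linarith)
    calc S.η (S.act g x') m ≤ C * (1 + LG g) ^ d * S.η x m := h1
      _ ≤ |C| * (1 + LG g) ^ d * S.η x m := by gcongr; exact le_abs_self C
      _ = |C| * S.η x m * 1 * (1 + LG g) ^ d := by ring
      _ ≤ _ := by gcongr
  have hδ : barδ M (MonoidHom.id G) 0 (fun _ => m) = 0 := by
    funext t
    rw [barδ_zero, sub_self]
    rfl
  exact ⟨Submodule.mkQ _ ⟨_, hf, hδ⟩, rfl⟩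

end PHom

/-! ### Sections, descent to `N`, and invariant classes on `K` -/

namespace IsShortExact

variable {K G N M : Type*} [Group K] [Group G] [Group N] [AddCommGroup M] [Module ℚ M]
  {LK : WordLength K} {LG : WordLength G} {LN : WordLength N} {i : K →* G} {p : G →* N}

/-- The normalisation at `1` is what later makes the extension of a cocycle of `K` restrict back to
that cocycle. -/
theorem exists_normalized_section (h : IsShortExact LK LG LN i p) :
    ∃ s : N → G, s 1 = 1 ∧ ∀ n, p (s n) = n ∧ LG (s n) = LN n := by
  classical
  choose s hs using h.exists_section
  refine ⟨Function.update s 1 1, Function.update_self _ _ _, fun n => ?_⟩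
  by_cases hn : n = 1
  · subst hn
    simp [LG.map_one, LN.map_one]
  · simpa [hn] using hs n

/-- Evaluate at lifts of minimal length: weights and lengths then agree with those in `N`, so the
same degree and constants serve. -/
theorem mem_PC_of_barPull_mem (h : IsShortExact LK LG LN i p) (S : PSModule.{w} LN M) {n : ℕ}
    {f : Bar N N n → M} (hf : barPull M p p n f ∈ PC (h.psG S) n) : f ∈ PC S n := by
  choose s hs hsL using h.exists_section
  have e : ∀ t : Bar N N n, barPull M p p n f (s t.1, s ∘ t.2) = f t := fun t =>
    congrArg f (Prod.ext (hs _) (funext fun j => hs _))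
  refine ⟨?_, fun m t => ?_⟩
  · obtain ⟨d, hd⟩ := hf.1
    refine ⟨d, fun x => (hd x).imp fun C hC m t => ?_⟩
    have h1 : S.η (S.act (p (s m)) x) _ ≤ _ := hC (s m) (s t.1, s ∘ t.2)
    have e1 : barWeight LG LG n (s t.1, s ∘ t.2) = barWeight LN LN n t := by
      simp [barWeight, hsL]
    rwa [e, e1, hs, hsL] at h1
  · have h1 := hf.2 (s m) (s t.1, s ∘ t.2)
    rw [e] at h1
    change f (p (s m * s t.1), p ∘ s ∘ t.2) = S.ρ (p (s m)) (f t) at h1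
    rw [map_mul, hs, hs, show p ∘ s ∘ t.2 = t.2 from funext fun j => hs _] at h1
    exact h1

/-- `K` acts trivially, so the coboundary of an equivariant 0-cochain vanishes and classes are
cocycles. -/
theorem mk_psK_eq_iff (h : IsShortExact LK LG LN i p) (S : PSModule.{w} LN M)
    (z z' : PZ (h.psK S) 1) :
    Cohomology.mk (δ := barδ M (MonoidHom.id K)) (C := PC (h.psK S)) 1 z =
      Cohomology.mk (δ := barδ M (MonoidHom.id K)) (C := PC (h.psK S)) 1 z' ↔ z = z' := by
  refine ⟨fun e => ?_, fun e => e ▸ rfl⟩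
  have h1 : (z - z' : Bar K K 1 → M) ∈
      coboundaries (barδ M (MonoidHom.id K)) (PC (h.psK S)) 1 :=
    (Submodule.Quotient.eq ((coboundaries (barδ M (MonoidHom.id K)) (PC (h.psK S)) 1).submoduleOf
      (PZ (h.psK S) 1))).1 e
  rw [h.coboundaries_psK S] at h1
  exact Subtype.ext (sub_eq_zero.1 h1)

theorem psG_apply_eq (h : IsShortExact LK LG LN i p) (S : PSModule.{w} LN M) {n : ℕ}
    {F : Bar G G n → M} (hF : F ∈ PC (h.psG S) n) (g : G) (t : Fin n → G) :
    F (g, t) = S.ρ (p g) (F (1, t)) :=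
  PC_apply_eq hF g t

/-- The coboundary, in inhomogeneous terms, of an equivariant 1-cochain. -/
theorem barδ_psG (h : IsShortExact LK LG LN i p) (S : PSModule.{w} LN M)
    {F : Bar G G 1 → M} (hF : F ∈ PC (h.psG S) 1) (a b : G) :
    barδ M (MonoidHom.id G) 1 F (1, ![a, b]) =
      S.ρ (p a) (F (1, fun _ => b)) - F (1, fun _ => a * b) + F (1, fun _ => a) := by
  rw [barδ_one, h.psG_apply_eq S hF (1 * _), one_mul]
  rfl

/-- The left side sees only `p a` and `p b`; comparing pairs with the same images gives relations
among the values of `F`. -/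
theorem apply_of_barδ_eq (h : IsShortExact LK LG LN i p) (S : PSModule.{w} LN M)
    {F : Bar G G 1 → M} (hF : F ∈ PC (h.psG S) 1) {c : Bar N N 2 → M}
    (hc : barδ M (MonoidHom.id G) 1 F = barPull M p p 2 c) (a b : G) :
    c (1, ![p a, p b]) =
      S.ρ (p a) (F (1, fun _ => b)) - F (1, fun _ => a * b) + F (1, fun _ => a) := by
  rw [← h.barδ_psG S hF, hc, barPull_two_apply, map_one]

theorem restrict_one_eq_zero (h : IsShortExact LK LG LN i p) (S : PSModule.{w} LN M)
    {F : Bar G G 1 → M} (hF : barPull M i i 1 F ∈ PZ (h.psK S) 1) : F (1, fun _ => 1) = 0 := by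
  have h1 := congrFun (show barδ M (MonoidHom.id K) 1 _ = 0 from hF.2) (1, ![1, 1])
  rw [barδ_one] at h1
  simpa [barPull_one_apply] using h1

/-- The action is defined on cocycles `f` of `K \ EG`, where it moves the base point to `(p g)⁻¹`.
The cocycle identity moves it back to `1` at the price of conjugating the argument by `g`. -/
theorem psH1_ρ_mk_eq_iff [Countable G] (h : IsShortExact LK LG LN i p) (S : PSModule.{w} LN M)
    (g : G) (φ : PZ (h.psK S) 1) :
    (h.psH1 S).ρ (p g) (Cohomology.mk 1 φ) = Cohomology.mk 1 φ ↔
      ∀ k k', i k' = g * i k * g⁻¹ →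
        (φ : Bar K K 1 → M) (1, fun _ => k') = S.ρ (p g) ((φ : Bar K K 1 → M) (1, fun _ => k)) := by
  obtain ⟨c, hc⟩ := h.compare_surjective S (Cohomology.mk 1 φ)
  have h1 : (h.psH1 S).ρ (p g) (h.compare S c) = h.compare S (QH1.rep LG p S (p g) c) := by
    have : Countable N := h.surjective.countable
    change h.compare S (QH1.rep LG p S (p g) ((LinearEquiv.ofBijective (h.compare S)
      (h.compare_bijective S)).symm (LinearEquiv.ofBijective (h.compare S)
      (h.compare_bijective S) c))) = _
    rw [LinearEquiv.symm_apply_apply]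
  rw [← hc, h1, hc]
  obtain ⟨⟨f, hf⟩, rfl⟩ := Submodule.mkQ_surjective _ c
  have hfφ : barPull M (p.comp i) i 1 f = φ := congrArg Subtype.val
    ((h.mk_psK_eq_iff S ⟨_, map_mem_cocycles (barPull M (p.comp i) i)
      (fun n f => barδ_barPull (p := p) (p' := MonoidHom.id K) rfl n f)
      (h.pull_mem_PC S) 1 f hf⟩ φ).1 hc)
  have ht := map_mem_cocycles (fun q => translate S q (p g)) (barδ_translate p S (p g))
    (translate_mem_QC S (p g)) 1 f hf
  have h2 := map_mem_cocycles (barPull M (p.comp i) i)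
      (fun n f => barδ_barPull (p := p) (p' := MonoidHom.id K) rfl n f) (h.pull_mem_PC S) 1 _ ht
  have hcoc : ∀ n a b, f (n, fun _ => a * b) = f (n * p a, fun _ => b) + f (n, fun _ => a) := by
    intro n a b
    have := congrFun (show barδ M p 1 f = 0 from hf.2) (n, ![a, b])
    rw [barδ_one] at this
    exact (sub_eq_zero.1 (by rw [Pi.zero_apply] at this; rw [← this]; abel)).symm
  -- Expand `f` at base point `1` on both factorisations of `g⁻¹ k' = k g⁻¹`; the term at `g⁻¹`
  -- cancels.
  have hval : ∀ k k', i k' = g * i k * g⁻¹ →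
      f ((p g)⁻¹, fun _ => i k') = (φ : Bar K K 1 → M) (1, fun _ => k) := by
    intro k k' hk
    have e1 := hcoc 1 g⁻¹ (i k')
    have e2 := hcoc 1 (i k) g⁻¹
    rw [show g⁻¹ * i k' = i k * g⁻¹ by rw [hk]; group, e2, h.p_i, one_mul, one_mul, map_inv,
      add_comm, add_left_inj] at e1
    rw [← e1, ← hfφ, barPull_one_apply, map_one]
  change Cohomology.mk 1 ⟨_, h2⟩ = _ ↔ _
  rw [h.mk_psK_eq_iff S, Subtype.ext_iff]
  have h3 : ∀ k k', i k' = g * i k * g⁻¹ → ∀ x,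
      barPull M (p.comp i) i 1 (translate S 1 (p g) f) (x, fun _ => k') =
        S.ρ (p g) ((φ : Bar K K 1 → M) (1, fun _ => k)) := by
    intro k k' hk x
    rw [barPull_one_apply]
    change S.ρ (p g) (f ((p g)⁻¹ * p (i x), _)) = _
    rw [h.p_i, mul_one, hval k k' hk]
  constructor
  · intro e k k' hk
    rw [← h3 k k' hk 1]
    exact (congrFun e _).symm
  · intro e
    refine bar_one_ext fun x k' => ?_
    obtain ⟨k, hk⟩ := h.lift (g := g⁻¹ * i k' * g) (by simp [h.p_i])
    have hk' : i k' = g * i k * g⁻¹ := by rw [hk]; group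
    refine (h3 k k' hk' x).trans ?_
    rw [← e k k' hk']
    exact (h.PC_apply S φ.2.1 x _).symm

/-- For `k' = g k g⁻¹`, expand `F` on `g k = k' g` in both ways. Both coboundary terms vanish
because `c` agrees there with its values at pairs containing `1`, leaving `F(k') = p(g) F(k)`. -/
theorem exists_eval_eq_restrict [Countable G] (h : IsShortExact LK LG LN i p)
    (S : PSModule.{w} LN M) {F : Bar G G 1 → M} (hF : F ∈ PC (h.psG S) 1)
    (hFK : barPull M i i 1 F ∈ PZ (h.psK S) 1) {c : Bar N N 2 → M}
    (hc : barδ M (MonoidHom.id G) 1 F = barPull M p p 2 c) :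
    ∃ z, PH.eval (h.psH1 S) z =
      Cohomology.mk (δ := barδ M (MonoidHom.id K)) (C := PC (h.psK S)) 1 ⟨_, hFK⟩ := by
  refine PH.exists_eval_eq _ fun n => ?_
  obtain ⟨g, rfl⟩ := h.surjective n
  rw [h.psH1_ρ_mk_eq_iff S]
  intro k k' hk
  simp only [barPull_one_apply, map_one]
  have h1 := h.restrict_one_eq_zero S hFK
  have hδ := h.apply_of_barδ_eq S hF hc
  -- The pairs `(g, k)` and `(g, 1)` have the same image in `N`.
  have e1 : S.ρ (p g) (F (1, fun _ => i k)) - F (1, fun _ => g * i k) + F (1, fun _ => g) = 0 := by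
    rw [← hδ, h.p_i]
    have := hδ g 1
    rw [map_one p] at this
    rw [this]
    simp [h1]
  -- The pairs `(k', g)` and `(1, g)` have the same image in `N`.
  have e2 : F (1, fun _ => g) - F (1, fun _ => g * i k) + F (1, fun _ => i k') = 0 := by
    have := hδ (i k') g
    rw [h.p_i, hk, inv_mul_cancel_right, map_one] at this
    have h2 := hδ 1 g
    rw [map_one, one_mul, h1, this] at h2
    simpa [← hk] using h2
  have e3 := e1.trans e2.symm
  rw [sub_add_eq_add_sub, sub_add_eq_add_sub, sub_left_inj, add_comm, add_right_inj] at e3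
  exact e3.symm

/-- Vanishing on `K` and an inflated coboundary force `F(kg) = F(g)`, so `F` is constant on the
fibres of `p`; p-boundedness then descends along minimal lifts. -/
theorem exists_barPull_eq (h : IsShortExact LK LG LN i p) (S : PSModule.{w} LN M)
    {F : Bar G G 1 → M} (hF : F ∈ PC (h.psG S) 1) (hFK : barPull M i i 1 F = 0)
    {c : Bar N N 2 → M} (hc : barδ M (MonoidHom.id G) 1 F = barPull M p p 2 c) :
    ∃ F' ∈ PC S 1, barPull M p p 1 F' = F := by
  have hK : ∀ k, F (1, fun _ => i k) = 0 := by
    intro k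
    have := congrFun hFK (1, fun _ => k)
    rwa [barPull_one_apply, map_one] at this
  have h1 : F (1, fun _ => 1) = 0 := by simpa using hK 1
  have hδ := h.apply_of_barδ_eq S hF hc
  -- Compare the pairs `(k, g)` and `(1, g)`, which have the same image in `N`.
  have hinv : ∀ k g, F (1, fun _ => i k * g) = F (1, fun _ => g) := by
    intro k g
    have e1 := hδ (i k) g
    have e2 := hδ 1 g
    rw [h.p_i, map_one, hK] at e1
    rw [map_one, h1, one_mul, e1] at e2
    exact (sub_eq_zero.1 (by simpa using e2)).symm
  choose s hs hsL using h.exists_section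
  have e : barPull M p p 1 (fun t => S.ρ t.1 (F (1, fun _ => s (t.2 0)))) = F := by
    refine bar_one_ext fun x a => ?_
    rw [barPull_one_apply, h.psG_apply_eq S hF x]
    obtain ⟨k, hk⟩ := h.lift (g := s (p a) * a⁻¹) (by simp [hs])
    have := hinv k a
    rw [hk, inv_mul_cancel_right] at this
    rw [this]
  exact ⟨_, h.mem_PC_of_barPull_mem S (by rw [e]; exact hF), e⟩

/-! ### Extension of invariant cocycles and the transgression -/

/-- If the p-bounded cochain `φ` on `K` is compatible with conjugation by `G` and `κ : G → K` grows
at most linearly, then `(g₀, g₁) ↦ g₀ φ (κ g₁)` is a p-bounded equivariant cochain on `G`. -/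
theorem extend_mem_PC (h : IsShortExact LK LG LN i p) (S : PSModule.{w} LN M) {φ : Bar K K 1 → M}
    (hφ : φ ∈ PC (h.psK S) 1)
    (hinv : ∀ g k k', i k' = g * i k * g⁻¹ → φ (1, fun _ => k') = S.ρ (p g) (φ (1, fun _ => k)))
    {κ : G → K} (hκ : ∀ g, LG (i (κ g)) ≤ 2 * LG g) :
    (fun t : Bar G G 1 => S.ρ (p t.1) (φ (1, fun _ => κ (t.2 0)))) ∈ PC (h.psG S) 1 := by
  refine ⟨?_, fun g t => ?_⟩
  · obtain ⟨C, d, hC⟩ := S.growth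
    obtain ⟨d', hd'⟩ := hφ.1
    -- The growth axiom is used twice (degree `d` each time) and the bound on `φ` once (degree
    -- `d'`).
    refine ⟨d + d + d', fun x => ?_⟩
    obtain ⟨y, hy⟩ := hC x
    obtain ⟨z, hz⟩ := hC y
    obtain ⟨D, hD⟩ := hd' z
    refine ⟨|C| * |C| * |D| * 2 ^ d', fun g t => ?_⟩
    -- The first growth estimate leaves an index translated by `p (g * t.1)`, where the bound on `φ`
    -- would have a constant depending on the translate. So write `m` as `(g * t.1)⁻¹` acting on the
    -- value `m'` at the conjugate `k'`: a second growth estimate returns the index to the fixed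
    -- `z`.
    obtain ⟨k', hk'⟩ := h.lift (g := g * t.1 * i (κ (t.2 0)) * (g * t.1)⁻¹) (by simp [h.p_i])
    set m := φ (1, fun _ => κ (t.2 0)) with hm
    set m' := φ (1, fun _ => k') with hm'
    have e1 : m' = S.ρ (p (g * t.1)) m := hinv _ _ _ hk'
    have e2 : S.ρ (p (g * t.1))⁻¹ m' = m := by
      rw [e1, ← Module.End.mul_apply, ← map_mul, inv_mul_cancel, map_one, Module.End.one_apply]
    have b1 := hy (p g) (p t.1) m
    have b2 := hz (p (g * t.1)) (p (g * t.1))⁻¹ m'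
    rw [e2, mul_inv_cancel, S.one_act, LN.map_inv, map_mul] at b2
    have b3 : S.η (S.act (p (i 1)) z) m' ≤
      D * (1 + (1 + barWeight LK LK 1 (1, fun _ => k'))) ^ d' * (1 + LK 1) ^ d' := hD 1 _
    rw [h.p_i, S.one_act, LK.map_one, add_zero, one_pow, mul_one] at b3
    have n1 := LG.nonneg g
    have n2 := LG.nonneg t.1
    have n3 := LG.nonneg (t.2 0)
    have w1 : barWeight LG LG 1 t = LG t.1 + (1 + LG (t.2 0)) := by simp [barWeight]
    have w2 : barWeight LK LK 1 (1, fun _ => k') = 1 + LK k' := by simp [barWeight, LK.map_one]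
    -- One quantity dominating every factor: the lengths of `p t.1` and `p (g * t.1)`, and, up to
    -- the factor 2, the length of `k'`.
    set P := (1 + (1 + barWeight LG LG 1 t)) * (1 + LG g) with hP
    have hPge : 2 + LG t.1 + LG (t.2 0) + LG g ≤ P := by
      rw [hP, w1]
      nlinarith
    have hP0 : 0 ≤ P := by linarith
    have q1 : 1 + LN (p t.1) ≤ P := by linarith [h.hom_right.le t.1]
    have q2 : 1 + LN (p g * p t.1) ≤ P := by
      linarith [h.hom_right.le t.1, h.hom_right.le g, LN.map_mul_le (p g) (p t.1)]
    have q3 : 1 + (1 + barWeight LK LK 1 (1, fun _ => k')) ≤ 2 * P := by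
      rw [w2, ← h.length_left, hk']
      have u1 := LG.map_mul_le (g * t.1 * i (κ (t.2 0))) (g * t.1)⁻¹
      have u2 := LG.map_mul_le (g * t.1) (i (κ (t.2 0)))
      have u3 := LG.map_mul_le g t.1
      rw [LG.map_inv] at u1
      linarith [hκ (t.2 0)]
    have n4 := LN.nonneg (p t.1)
    have n5 := LN.nonneg (p g * p t.1)
    have n6 := barWeight_nonneg LK LK 1 (1, fun _ => k')
    have c3 : S.η z m' ≤ |D| * (2 * P) ^ d' := by
      refine b3.trans ?_
      gcongr
      exact le_abs_self D
    have c2 : S.η (S.act (p g * p t.1) y) m ≤ |C| * P ^ d * (|D| * (2 * P) ^ d') := by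
      refine b2.trans ?_
      have := apply_nonneg (S.η z) m'
      gcongr
      exact le_abs_self C
    calc S.η (S.act (p g) x) (S.ρ (p t.1) m)
        ≤ C * (1 + LN (p t.1)) ^ d * S.η (S.act (p g * p t.1) y) m := b1
      _ ≤ |C| * P ^ d * (|C| * P ^ d * (|D| * (2 * P) ^ d')) := by
          have := apply_nonneg (S.η (S.act (p g * p t.1) y)) m
          gcongr
          exact le_abs_self C
      _ = |C| * |C| * |D| * 2 ^ d' * P ^ (d + d + d') := by
          rw [mul_pow 2 P, pow_add, pow_add]
          ring
      _ = _ := by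
          rw [hP, mul_pow _ _ (d + d + d'), ← mul_assoc]
  · change S.ρ (p (g * t.1)) _ = S.ρ (p g) (S.ρ (p t.1) _)
    rw [map_mul, map_mul]
    rfl

/-- Extend an invariant `φ` along `κ g = g s(p g)⁻¹`. As `φ` is an invariant homomorphism, the
failure of `κ` to be multiplicative contributes only `φ` of the factor set `σ` of `s`, which lives
on `N`. -/
theorem exists_transgresses [Countable G] (h : IsShortExact LK LG LN i p) (S : PSModule.{w} LN M)
    (z : PH (h.psH1 S) 0) : ∃ c, h.Transgresses S z c := by
  obtain ⟨φ, hφz⟩ := Submodule.mkQ_surjective _ (PH.eval (h.psH1 S) z)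
  have hinv : ∀ g k k', i k' = g * i k * g⁻¹ →
      (φ : Bar K K 1 → M) (1, fun _ => k') =
        S.ρ (p g) ((φ : Bar K K 1 → M) (1, fun _ => k)) := by
    intro g
    refine (h.psH1_ρ_mk_eq_iff S g φ).1 ?_
    have := PH.ρ_eval (h.psH1 S) (p g) z
    rwa [← hφz] at this
  obtain ⟨φ, hφ, hφδ⟩ := φ
  simp only at hinv
  have hmul : ∀ a b, φ (1, fun _ => a * b) = φ (1, fun _ => a) + φ (1, fun _ => b) := by
    intro a b
    have := congrFun (show barδ M (MonoidHom.id K) 1 φ = 0 from hφδ) (1, ![a, b])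
    rw [barδ_one, h.PC_apply S hφ] at this
    exact (sub_eq_zero.1 (by rw [Pi.zero_apply] at this; rw [← this]; abel)).symm
  obtain ⟨s, hs1, hs⟩ := h.exists_normalized_section
  choose κ hκ using fun g => h.lift (g := g * (s (p g))⁻¹) (by simp [hs])
  choose σ hσ using fun m n => h.lift (g := s m * s n * (s (m * n))⁻¹) (by simp [hs])
  have hF := h.extend_mem_PC S hφ hinv (κ := κ) fun g => by
    rw [hκ]
    have e1 := LG.map_mul_le g (s (p g))⁻¹
    rw [LG.map_inv, (hs _).2] at e1
    linarith [h.hom_right.le g]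
  set F : Bar G G 1 → M := fun t => S.ρ (p t.1) (φ (1, fun _ => κ (t.2 0))) with hFdef
  have hFi : barPull M i i 1 F = φ := by
    refine bar_one_ext fun x a => ?_
    -- The choice `s 1 = 1` enters here.
    have e : κ (i a) = a := h.injective (by rw [hκ, h.p_i, hs1, inv_one, mul_one])
    change S.ρ (p (i x)) (φ (1, fun _ => κ (i a))) = _
    rw [h.p_i, map_one, e, h.PC_apply S hφ x]
    rfl
  let c : Bar N N 2 → M := fun t => S.ρ t.1 (-φ (1, fun _ => σ (t.2 0) (t.2 1)))
  have hc : barδ M (MonoidHom.id G) 1 F = barPull M p p 2 c := by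
    refine bar_two_ext fun x a b => ?_
    obtain ⟨l, hl⟩ := h.lift (g := s (p a) * i (κ b) * (s (p a))⁻¹) (by simp [h.p_i])
    -- Applying `φ`, the conjugate `l` gives `p a` acting on `φ (κ b)`; all but the `σ` term cancels
    -- in the coboundary.
    have e : κ (a * b) = κ a * l * σ (p a) (p b) := by
      apply h.injective
      simp only [map_mul, hκ, hl, hσ]
      group
    have e' := hinv _ _ _ hl
    rw [(hs _).1] at e'
    rw [barPull_two_apply, barδ_one]
    change S.ρ (p (x * a)) (φ (1, fun _ => κ b)) - S.ρ (p x) (φ (1, fun _ => κ (a * b))) +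
      S.ρ (p x) (φ (1, fun _ => κ a)) = S.ρ (p x) (-φ (1, fun _ => σ (p a) (p b)))
    rw [e, hmul, hmul, e', map_mul, map_mul, Module.End.mul_apply]
    simp only [map_add, map_neg]
    abel
  -- No estimate on `σ` is needed: the inflation of `c` is the coboundary of a p-bounded cochain.
  have hcPC : c ∈ PC S 2 := h.mem_PC_of_barPull_mem S (hc ▸ barδ_one_mem_PC hF)
  have hcδ : barδ M (MonoidHom.id N) 2 c = 0 := by
    apply barPull_injective (M := M) h.surjective h.surjective 3
    rw [← barδ_barPull (p := MonoidHom.id N) (p' := MonoidHom.id G) rfl, ← hc,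
      barδ_two_barδ_one, map_zero]
  refine ⟨⟨c, hcPC, hcδ⟩, F, hF, hFi ▸ ⟨hφ, hφδ⟩, ?_, hc⟩
  rw [← hφz]
  exact ((h.mk_psK_eq_iff S _ _).2 (Subtype.ext hFi)).symm

theorem Transgresses.add [Countable G] {h : IsShortExact LK LG LN i p} {S : PSModule.{w} LN M}
    {z z' : PH (h.psH1 S) 0} {c c' : PZ S 2} (H : h.Transgresses S z c)
    (H' : h.Transgresses S z' c') : h.Transgresses S (z + z') (c + c') := by
  obtain ⟨F, hF, hFK, hz, hc⟩ := H
  obtain ⟨F', hF', hFK', hz', hc'⟩ := H'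
  refine ⟨F + F', add_mem hF hF', by rw [map_add]; exact add_mem hFK hFK', ?_, ?_⟩
  · rw [map_add, hz, hz']
    exact (map_add (Cohomology.mk 1) _ _).symm.trans (congrArg _ (Subtype.ext (map_add _ _ _).symm))
  · rw [map_add, hc, hc', Submodule.coe_add, map_add]

theorem Transgresses.smul [Countable G] {h : IsShortExact LK LG LN i p} {S : PSModule.{w} LN M}
    {z : PH (h.psH1 S) 0} {c : PZ S 2} (H : h.Transgresses S z c) (q : ℚ) :
    h.Transgresses S (q • z) (q • c) := by
  obtain ⟨F, hF, hFK, hz, hc⟩ := H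
  refine ⟨q • F, Submodule.smul_mem _ q hF, by rw [map_smul]; exact Submodule.smul_mem _ q hFK,
    ?_, ?_⟩
  · rw [map_smul, hz]
    exact (map_smul (Cohomology.mk 1) q _).symm.trans
      (congrArg _ (Subtype.ext (map_smul _ _ _).symm))
  · rw [map_smul, hc, Submodule.coe_smul, map_smul]

/-- Without coboundaries on `K`, a cochain representing `0` restricts to zero, hence is inflated,
and what it is inflated from bounds `c`. -/
theorem Transgresses.mk_eq_zero [Countable G] {h : IsShortExact LK LG LN i p}
    {S : PSModule.{w} LN M} {c : PZ S 2} (H : h.Transgresses S 0 c) :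
    Cohomology.mk (δ := barδ M (MonoidHom.id N)) (C := PC S) 2 c = 0 := by
  obtain ⟨F, hF, hFK, hz, hc⟩ := H
  have h0 : barPull M i i 1 F = 0 := by
    rw [map_zero, ← map_zero (Cohomology.mk 1), eq_comm, h.mk_psK_eq_iff S] at hz
    exact congrArg Subtype.val hz
  obtain ⟨F', hF', rfl⟩ := h.exists_barPull_eq S hF h0 hc
  rw [barδ_barPull (p := MonoidHom.id N) (p' := MonoidHom.id G) rfl] at hc
  exact (Submodule.Quotient.mk_eq_zero _).2
    ⟨F', hF', barPull_injective h.surjective h.surjective 2 hc⟩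

theorem Transgresses.mk_eq [Countable G] {h : IsShortExact LK LG LN i p}
    {S : PSModule.{w} LN M} {z : PH (h.psH1 S) 0} {c c' : PZ S 2} (H : h.Transgresses S z c)
    (H' : h.Transgresses S z c') :
    Cohomology.mk (δ := barδ M (MonoidHom.id N)) (C := PC S) 2 c = Cohomology.mk 2 c' := by
  have h1 := H.add (H'.smul (-1))
  rw [neg_one_smul, show (-1 : ℚ) • c' = -c' from neg_one_smul ℚ c', add_neg_cancel,
    ← sub_eq_add_neg] at h1
  rw [← sub_eq_zero, ← map_sub]
  exact h1.mk_eq_zero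

/-- Cocycles are chosen arbitrarily; linearity follows because the relation is linear and determines
the class of the cocycle. -/
theorem exists_transgression [Countable G] (h : IsShortExact LK LG LN i p)
    (S : PSModule.{w} LN M) : ∃ tg : PH (h.psH1 S) 0 →ₗ[ℚ] PH S 2,
      ∀ z c, h.Transgresses S z c → tg z = Cohomology.mk 2 c := by
  choose c hc using h.exists_transgresses S
  refine ⟨
    { toFun := fun z => Cohomology.mk (δ := barδ M (MonoidHom.id N)) (C := PC S) 2 (c z)
      map_add' := fun z z' => ?_
      map_smul' := fun q z => ?_ }, fun z c' H => Transgresses.mk_eq (hc z) H⟩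
  · rw [← map_add]
    exact Transgresses.mk_eq (hc _) (Transgresses.add (hc z) (hc z'))
  · rw [RingHom.id_apply, ← map_smul]
    exact Transgresses.mk_eq (hc _) (Transgresses.smul (hc z) q)

/-! ### Restriction, inflation and exactness -/

/-- Restrictions of cocycles of `G` are invariant, by the case `c = 0` of `exists_eval_eq_restrict`;
injectivity of evaluation gives linearity. -/
theorem exists_restriction [Countable G] (h : IsShortExact LK LG LN i p)
    (S : PSModule.{w} LN M) : ∃ res : PH (h.psG S) 1 →ₗ[ℚ] PH (h.psH1 S) 0,
      ∀ c, PH.eval (h.psH1 S) (res c) = PH.map (h.psG S) i h.hom_left.le 1 c := by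
  have hex : ∀ c, ∃ z, PH.eval (h.psH1 S) z = PH.map (h.psG S) i h.hom_left.le 1 c := by
    intro c
    obtain ⟨⟨f, hf, hδ⟩, rfl⟩ := Submodule.mkQ_surjective _ c
    exact h.exists_eval_eq_restrict S hf (map_mem_cocycles (barPull M i i)
      (fun n f => barδ_barPull (p := MonoidHom.id G) (p' := MonoidHom.id K) rfl n f)
      (barPull_mem_PC (h.psG S) i h.hom_left.le) 1 f ⟨hf, hδ⟩) (c := 0)
      ((show barδ M (MonoidHom.id G) 1 f = 0 from hδ).trans (map_zero _).symm)
  choose r hr using hex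
  refine ⟨
    { toFun := r
      map_add' := fun c c' => PH.eval_injective _ ?_
      map_smul' := fun q c => PH.eval_injective _ ?_ }, hr⟩
  · rw [hr, map_add, map_add, hr, hr]
  · rw [RingHom.id_apply, hr, map_smul, map_smul, hr]

theorem inflate_mem_PZ (h : IsShortExact LK LG LN i p) (S : PSModule.{w} LN M) {n : ℕ}
    {c : Bar N N n → M} (hc : c ∈ PZ S n) : barPull M p p n c ∈ PZ (h.psG S) n :=
  map_mem_cocycles (barPull M p p)
    (fun n f => barδ_barPull (p := MonoidHom.id N) (p' := MonoidHom.id G) rfl n f)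
    (barPull_mem_PC S p h.hom_right.le) n c hc

theorem restrict_mem_PZ (h : IsShortExact LK LG LN i p) (S : PSModule.{w} LN M) {n : ℕ}
    {f : Bar G G n → M} (hf : f ∈ PZ (h.psG S) n) : barPull M i i n f ∈ PZ (h.psK S) n :=
  map_mem_cocycles (barPull M i i)
    (fun n f => barδ_barPull (p := MonoidHom.id G) (p' := MonoidHom.id K) rfl n f)
    (barPull_mem_PC (h.psG S) i h.hom_left.le) n f hf

theorem inflation_injective (h : IsShortExact LK LG LN i p) (S : PSModule.{w} LN M) :
    Function.Injective (PH.map S p h.hom_right.le 1) := by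
  rw [injective_iff_map_eq_zero]
  intro x hx
  obtain ⟨⟨c, hc⟩, rfl⟩ := Submodule.mkQ_surjective _ x
  have h0 : Cohomology.mk (δ := barδ M (MonoidHom.id G)) (C := PC (h.psG S)) 1
    ⟨_, h.inflate_mem_PZ S hc⟩ = 0 := hx
  obtain ⟨b, hb, hbc⟩ := (Submodule.Quotient.mk_eq_zero _).1 h0
  -- `G` acts through `p`, so every equivariant 0-cochain of `G` is inflated.
  have e : barPull M p p 0 (fun t => S.ρ t.1 (b (1, Fin.elim0))) = b := by
    funext ⟨g, t⟩
    rw [h.psG_apply_eq S hb g, Subsingleton.elim t Fin.elim0]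
    rfl
  refine (Submodule.Quotient.mk_eq_zero _).2
    ⟨_, h.mem_PC_of_barPull_mem S (by rw [e]; exact hb), ?_⟩
  apply barPull_injective (M := M) h.surjective h.surjective 1
  rw [← barδ_barPull (p := MonoidHom.id N) (p' := MonoidHom.id G) rfl, e]
  exact hbc

/-- The inflation of a cochain of `N` that vanishes at `1` vanishes on `K`. -/
theorem restrict_inflate_eq_zero (h : IsShortExact LK LG LN i p)
    {b : Bar N N 1 → M} (hb : b (1, fun _ => 1) = 0) : barPull M i i 1 (barPull M p p 1 b) = 0 := by
  refine bar_one_ext fun x a => ?_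
  rw [barPull_one_apply, barPull_one_apply, h.p_i, h.p_i]
  exact hb

theorem exact_inflation_restriction [Countable G] (h : IsShortExact LK LG LN i p)
    (S : PSModule.{w} LN M) {res : PH (h.psG S) 1 →ₗ[ℚ] PH (h.psH1 S) 0}
    (hres : ∀ c, PH.eval (h.psH1 S) (res c) = PH.map (h.psG S) i h.hom_left.le 1 c) :
    Function.Exact (PH.map S p h.hom_right.le 1) res := by
  have hiff : ∀ f (hf : f ∈ PZ (h.psG S) 1), res (Cohomology.mk 1 ⟨f, hf⟩) = 0 ↔
      barPull M i i 1 f = 0 := by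
    intro f hf
    rw [← (PH.eval_injective (h.psH1 S)).eq_iff, hres, map_zero]
    change Cohomology.mk (δ := barδ M (MonoidHom.id K)) (C := PC (h.psK S)) 1
      ⟨_, h.restrict_mem_PZ S hf⟩ = 0 ↔ _
    rw [← map_zero (Cohomology.mk 1), h.mk_psK_eq_iff S, Subtype.ext_iff]
    rfl
  intro y
  constructor
  · obtain ⟨⟨f, hf⟩, rfl⟩ := Submodule.mkQ_surjective _ y
    intro hy
    have hδ : barδ M (MonoidHom.id G) 1 f = 0 := hf.2
    obtain ⟨c, hc, rfl⟩ := h.exists_barPull_eq S hf.1 ((hiff f hf).1 hy) (c := 0)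
      (hδ.trans (map_zero _).symm)
    rw [barδ_barPull (p := MonoidHom.id N) (p' := MonoidHom.id G) rfl] at hδ
    exact ⟨Cohomology.mk 1 ⟨c, hc,
      barPull_injective h.surjective h.surjective 2 (hδ.trans (map_zero _).symm)⟩, rfl⟩
  · rintro ⟨x, rfl⟩
    obtain ⟨⟨c, hc⟩, rfl⟩ := Submodule.mkQ_surjective _ x
    refine (hiff _ (h.inflate_mem_PZ S hc)).2 (h.restrict_inflate_eq_zero ?_)
    -- A 1-cocycle vanishes at the identity, so its inflation vanishes on `K`.
    rw [← barδ_one_apply_one (MonoidHom.id N) c, show barδ M (MonoidHom.id N) 1 c = 0 from hc.2]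
    rfl

/-- If `c = δb`, then `F` minus the inflation of `b` is a cocycle with the same restriction to `K`.
Conversely, a cocycle of `G` witnesses that its restriction transgresses to `0`. -/
theorem exact_restriction_transgression [Countable G] (h : IsShortExact LK LG LN i p)
    (S : PSModule.{w} LN M) {res : PH (h.psG S) 1 →ₗ[ℚ] PH (h.psH1 S) 0}
    (hres : ∀ c, PH.eval (h.psH1 S) (res c) = PH.map (h.psG S) i h.hom_left.le 1 c)
    {tg : PH (h.psH1 S) 0 →ₗ[ℚ] PH S 2}
    (htg : ∀ z c, h.Transgresses S z c → tg z = Cohomology.mk 2 c) :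
    Function.Exact res tg := by
  intro z
  constructor
  · intro hz
    obtain ⟨⟨c, hc⟩, H⟩ := h.exists_transgresses S z
    have hc0 := (htg z _ H).symm.trans hz
    obtain ⟨b, hb, rfl⟩ := (Submodule.Quotient.mk_eq_zero _).1 hc0
    obtain ⟨F, hF, hFK, hzF, hδ⟩ := H
    simp only at hδ
    -- This value is that of `δb` at the identity pair, which equals `F(1) = 0`.
    have hb1 : b (1, fun _ => 1) = 0 := by
      have e := h.apply_of_barδ_eq S hF hδ 1 1
      rw [map_one, barδ_one_apply_one, mul_one, h.restrict_one_eq_zero S hFK] at e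
      simpa using e
    have hf : F - barPull M p p 1 b ∈ PZ (h.psG S) 1 := by
      refine ⟨sub_mem hF (barPull_mem_PC S p h.hom_right.le 1 b hb), ?_⟩
      change barδ M (MonoidHom.id G) 1 _ = 0
      rw [map_sub, hδ, barδ_barPull (p := MonoidHom.id N) (p' := MonoidHom.id G) rfl, sub_self]
    refine ⟨Cohomology.mk 1 ⟨_, hf⟩, PH.eval_injective _ ?_⟩
    rw [hres, hzF]
    refine (h.mk_psK_eq_iff S ⟨_, h.restrict_mem_PZ S hf⟩ _).2 (Subtype.ext ?_)
    change barPull M i i 1 (F - barPull M p p 1 b) = _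
    rw [map_sub, h.restrict_inflate_eq_zero hb1, sub_zero]
  · rintro ⟨y, rfl⟩
    obtain ⟨⟨f, hf⟩, rfl⟩ := Submodule.mkQ_surjective _ y
    rw [htg _ 0 ⟨f, hf.1, h.restrict_mem_PZ S hf, hres _,
      (show barδ M (MonoidHom.id G) 1 f = 0 from hf.2).trans (map_zero _).symm⟩, map_zero]

/-- A bounding cochain `F` of the inflated `c` shows that `c` is a transgression, once `c` is
normalised so that `F` is a cocycle on `K`. -/
theorem exact_transgression_inflation [Countable G] (h : IsShortExact LK LG LN i p)
    (S : PSModule.{w} LN M) {tg : PH (h.psH1 S) 0 →ₗ[ℚ] PH S 2}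
    (htg : ∀ z c, h.Transgresses S z c → tg z = Cohomology.mk 2 c) :
    Function.Exact tg (PH.map S p h.hom_right.le 2) := by
  intro y
  constructor
  · obtain ⟨⟨c, hc⟩, rfl⟩ := Submodule.mkQ_surjective _ y
    intro hy
    have h0 : Cohomology.mk (δ := barδ M (MonoidHom.id G)) (C := PC (h.psG S)) 2
      ⟨_, h.inflate_mem_PZ S hc⟩ = 0 := hy
    obtain ⟨F, hF, hFc⟩ := (Submodule.Quotient.mk_eq_zero _).1 h0
    have hδ : barδ M (MonoidHom.id G) 1 F = barPull M p p 2 c := hFc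
    -- Chosen so that `δb` agrees with `c` at the identity pair: `c - δb` is a cohomologous cocycle
    -- vanishing there.
    let b : Bar N N 1 → M := fun t => c (t.1, ![1, 1])
    have hb : b ∈ PC S 1 := by
      refine ⟨S.PHom_comp hc.1.1 (fun t : Bar N N 1 => (t.1, ![1, 1])) fun t => ?_,
        fun g t => PC_apply_mul hc.1 _ _ _⟩
      simpa [barWeight, LN.map_one] using LN.nonneg (t.2 0)
    have hbδ : barδ M (MonoidHom.id N) 1 b ∈ coboundaries (barδ M (MonoidHom.id N)) (PC S) 2 :=
      ⟨b, hb, rfl⟩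
    have hc' : c - barδ M (MonoidHom.id N) 1 b ∈ PZ S 2 :=
      sub_mem hc ⟨barδ_one_mem_PC hb, barδ_two_barδ_one _ b⟩
    have hF' : F - barPull M p p 1 b ∈ PC (h.psG S) 1 :=
      sub_mem hF (barPull_mem_PC S p h.hom_right.le 1 b hb)
    have hδ' : barδ M (MonoidHom.id G) 1 (F - barPull M p p 1 b) =
        barPull M p p 2 (c - barδ M (MonoidHom.id N) 1 b) := by
      rw [map_sub, map_sub, hδ, barδ_barPull (p := MonoidHom.id N) (p' := MonoidHom.id G) rfl]
    have hc1 : (c - barδ M (MonoidHom.id N) 1 b) (1, ![1, 1]) = 0 := by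
      rw [Pi.sub_apply, barδ_one_apply_one, sub_self]
    -- On `K` the coboundary is constant, equal to the normalised cocycle at the identity pair,
    -- hence zero.
    have hFK : barPull M i i 1 (F - barPull M p p 1 b) ∈ PZ (h.psK S) 1 := by
      refine ⟨barPull_mem_PC (h.psG S) i h.hom_left.le 1 _ hF', ?_⟩
      change barδ M (MonoidHom.id K) 1 _ = 0
      rw [barδ_barPull (p := MonoidHom.id G) (p' := MonoidHom.id K) rfl, hδ']
      refine bar_two_ext fun x k l => ?_
      rw [barPull_two_apply, barPull_two_apply, h.p_i, h.p_i, h.p_i]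
      exact hc1
    obtain ⟨z, hz⟩ := h.exists_eval_eq_restrict S hF' hFK hδ'
    refine ⟨z, ?_⟩
    rw [htg z ⟨_, hc'⟩ ⟨_, hF', hFK, hz, hδ'⟩]
    refine (Submodule.Quotient.eq _).2 ?_
    change c - barδ M (MonoidHom.id N) 1 b - c ∈
      coboundaries (barδ M (MonoidHom.id N)) (PC S) 2
    rw [sub_sub_cancel_left]
    exact neg_mem hbδ
  · rintro ⟨z, rfl⟩
    obtain ⟨c, H⟩ := h.exists_transgresses S z
    rw [htg z c H]
    obtain ⟨F, hF, -, -, hδ⟩ := H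
    exact (Submodule.Quotient.mk_eq_zero _).2 ⟨F, hF, hδ⟩

end IsShortExact

end PBdd

theorem theorem1p1p25 {K G N : Type*} [Group K] [Group G] [Group N] [Countable G]
    {LK : PBdd.WordLength K} {LG : PBdd.WordLength G} {LN : PBdd.WordLength N}
    {i : K →* G} {p : G →* N} (h : PBdd.IsShortExact LK LG LN i p)
    {M : Type*} [AddCommGroup M] [Module ℚ M] (S : PBdd.PSModule LN M) :
    ∃ (res : PBdd.PH (h.psG S) 1 →ₗ[ℚ] PBdd.PH (h.psH1 S) 0)
      (tg : PBdd.PH (h.psH1 S) 0 →ₗ[ℚ] PBdd.PH S 2),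
      (∀ c, PBdd.PH.eval (h.psH1 S) (res c) = PBdd.PH.map (h.psG S) i h.hom_left.le 1 c) ∧
      (∀ z, (∃ c, h.Transgresses S z c) ∧
        ∀ c, h.Transgresses S z c → tg z = PBdd.Cohomology.mk 2 c) ∧
      Function.Injective (PBdd.PH.map S p h.hom_right.le 1) ∧
      Function.Exact (PBdd.PH.map S p h.hom_right.le 1) res ∧
      Function.Exact res tg ∧
      Function.Exact tg (PBdd.PH.map S p h.hom_right.le 2) := by
  obtain ⟨res, hres⟩ := h.exists_restriction S
  obtain ⟨tg, htg⟩ := h.exists_transgression S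
  exact ⟨res, tg, hres, fun z => ⟨h.exists_transgresses S z, htg z⟩, h.inflation_injective S,
    h.exact_inflation_restriction S hres, h.exact_restriction_transgression S hres htg,
    h.exact_transgression_inflation S htg⟩
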